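/- Let $d\ge 1$. A convex body is a compact convex set with non-empty interior, and a $d$-lattice is a discrete subgroup $\Lambda$ of a $d$-dimensional Euclidean space $E$ (e.g. $E=\mathbb R^d$) that spans $E$; its dual is $\Lambda^\star=\{y\in E: x\cdot y\in\mathbb Z\ \forall x\in\Lambda\}$. The lattice width of $C$ is $\mathrm{width}_\Lambda(C)=\min_{y\in\Lambda^\star\setminus\{0\}}\max_{a,b\in C}y\cdot(a-b)$, and the $y$ attaining the minimum are the width directions of $C$. A vector $v\in\Lambda\setminus\{0\}$ is primitive if $tv\notin\Lambda$ for all $0<t<1$. A segment $[a,b]$ with $a\neq b$ is a lattice segment with primitive direction $v$ if $v\in\Lambda$ is primitive and $b-a$ is a positive multiple of $v$; its lattice length is $|b-a|/|v|$. The lattice diameter $\mathrm{diam}_\Lambda(C)$ is the maximal lattice length of a lattice segment contained in $C$, and the primitive directions of the segments attaining it are the diameter directions of $C$. A convex body $C$ is lattice reduced with respect to $\Lambda$ if no convex body $C'\subsetneq C$ has $\mathrm{width}_\Lambda(C')=\mathrm{width}_\Lambda(C)$, and lattice complete with respect to $\Lambda$ if no convex body $C'\supsetneq C$ has $\mathrm{diam}_\Lambda(C')=\mathrm{diam}_\Lambda(C)$.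 Let $\Lambda\subset\mathbb R^d$ be a $d$-lattice and let $C\subset\mathbb R^d$ be a convex body. 1. If $C$ is lattice reduced with respect to $\Lambda$, then $C$ is a polytope with at most $2^{d+1}-2$ vertices. More precisely, it has at most $2^{k+1}-2$ vertices, where $k$ is the dimension of the linear span of the width directions of $C$. 2. If $C$ is lattice complete with respect to $\Lambda$, then $C$ is a polytope with at most $2^{d+1}-2$ facets. More precisely, it has at most $2^{k+1}-2$ facets, where $k$ is the dimension of the linear span of the diameter directions of $C$. The bound $2^{d+1}-2$ is best possible in both statements: for every $d\ge1$ and every $d$-lattice $\Lambda\subset\mathbb R^d$ there are a convex body that is lattice reduced with respect to $\Lambda$ and has exactly $2^{d+1}-2$ vertices, and a convex body that is lattice complete with respect to $\Lambda$ and has exactly $2^{d+1}-2$ facets. Explicitly, let $A_d=\{x\in\mathbb Z^{d+1}:\sum_i x_i=0\}$, a $d$-lattice in the hyperplane $H=\{x\in\mathbb R^{d+1}:\sum_i x_i=0\}$, with dual $A_d^\star\subset H$, and let $V=\{x\in H:|x|\le|x-a|\ \forall a\in A_d^\star\}$ be the Voronoi cell of $A_d^\star$. Then $V$ is lattice complete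 with respect to $A_d^\star$ and has exactly $2^{d+1}-2$ facets, and its polar $V^\star=\{y\in H: x\cdot y\le1\ \forall x\in V\}$ is lattice reduced with respect to $A_d$ and has exactly $2^{d+1}-2$ vertices. -/

import Mathlib

open scoped RealInnerProductSpace

section LatticeBodies

variable {E : Type*} [NormedAddCommGroup E] [InnerProductSpace ℝ E]

/-- Convex bodies: compact convex sets with non-empty interior. -/
def IsConvexBody (C : Set E) : Prop :=
  Convex ℝ C ∧ IsCompact C ∧ (interior C).Nonempty

/-- The dual lattice: all `y` whose inner product with every `x ∈ Λ` is an integer. -/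
noncomputable def dualLattice (Λ : Submodule ℤ E) : Submodule ℤ E :=
  LinearMap.BilinForm.dualSubmodule (innerₗ E) Λ

theorem mem_dualLattice (Λ : Submodule ℤ E) (y : E) :
    y ∈ dualLattice Λ ↔ ∀ x ∈ Λ, ∃ n : ℤ, ⟪x, y⟫ = n := by
  simp only [dualLattice, LinearMap.BilinForm.mem_dualSubmodule, Submodule.mem_one,
    innerₗ_apply_apply, real_inner_comm]
  simp [eq_comm]

/-- The width of `C` in direction `y`, i.e. the maximum of `y · (a - b)` over `a, b ∈ C`. -/
noncomputable def directionalWidth (C : Set E) (y : E) : ℝ :=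
  sSup {r : ℝ | ∃ a ∈ C, ∃ b ∈ C, r = ⟪y, a - b⟫}

/-- The lattice width: the minimum of the directional widths over all nonzero vectors of the
dual lattice. -/
noncomputable def latticeWidth (Λ : Submodule ℤ E) (C : Set E) : ℝ :=
  sInf {r : ℝ | ∃ y ∈ dualLattice Λ, y ≠ 0 ∧ r = directionalWidth C y}

/-- The nonzero dual lattice vectors in which the lattice width is attained. -/
def widthDirections (Λ : Submodule ℤ E) (C : Set E) : Set E :=
  {y : E | y ∈ dualLattice Λ ∧ y ≠ 0 ∧ directionalWidth C y = latticeWidth Λ C}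

/-- Primitive lattice vectors: `v ∈ Λ` nonzero, with no lattice point strictly between
`0` and `v`. -/
def IsPrimitiveVector (Λ : Submodule ℤ E) (v : E) : Prop :=
  v ∈ Λ ∧ v ≠ 0 ∧ ∀ t : ℝ, 0 < t → t < 1 → t • v ∉ Λ

/-- `[a, b]` is a (non-degenerate) lattice segment and `v` is its primitive direction. -/
def IsPrimitiveDirection (Λ : Submodule ℤ E) (a b v : E) : Prop :=
  IsPrimitiveVector Λ v ∧ ∃ t : ℝ, 0 < t ∧ b - a = t • v

/-- The lattice diameter: the maximal lattice length `|b - a| / |v|` of a lattice segment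
`[a, b] ⊆ C`, where `v` is the primitive direction of `[a, b]`. -/
noncomputable def latticeDiameter (Λ : Submodule ℤ E) (C : Set E) : ℝ :=
  sSup {r : ℝ | ∃ a b v : E, segment ℝ a b ⊆ C ∧ IsPrimitiveDirection Λ a b v ∧
    r = ‖b - a‖ / ‖v‖}

/-- The primitive directions of the lattice segments in `C` that attain the lattice diameter. -/
def diameterDirections (Λ : Submodule ℤ E) (C : Set E) : Set E :=
  {v : E | ∃ a b : E, segment ℝ a b ⊆ C ∧ IsPrimitiveDirection Λ a b v ∧
    ‖b - a‖ / ‖v‖ = latticeDiameter Λ C}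

/-- `C` is a convex body no proper sub-body of which has the same lattice width. -/
def IsLatticeReduced (Λ : Submodule ℤ E) (C : Set E) : Prop :=
  IsConvexBody C ∧
    ¬ ∃ C' : Set E, IsConvexBody C' ∧ C' ⊂ C ∧ latticeWidth Λ C' = latticeWidth Λ C

/-- `C` is a convex body no proper super-body of which has the same lattice diameter. -/
def IsLatticeComplete (Λ : Submodule ℤ E) (C : Set E) : Prop :=
  IsConvexBody C ∧
    ¬ ∃ C' : Set E, IsConvexBody C' ∧ C ⊂ C' ∧ latticeDiameter Λ C' = latticeDiameter Λ C

/-- A polytope is the convex hull of a finite set. -/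
def IsPolytope (P : Set E) : Prop :=
  ∃ A : Set E, A.Finite ∧ P = convexHull ℝ A

/-- The vertices are the extreme points. -/
def polytopeVertices (P : Set E) : Set E :=
  Set.extremePoints ℝ P

/-- The facets: non-empty faces (convex extreme subsets) of dimension `dim P - 1`, where the
dimension of a set is that of its affine hull. -/
def polytopeFacets (P : Set E) : Set (Set E) :=
  {F : Set E | F.Nonempty ∧ Convex ℝ F ∧ IsExtreme ℝ P F ∧
    Module.finrank ℝ (vectorSpan ℝ F) + 1 = Module.finrank ℝ (vectorSpan ℝ P)}

/-- The Voronoi cell of `Λ` around the origin. -/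
def voronoiCell (Λ : Submodule ℤ E) : Set E :=
  {x : E | ∀ a ∈ Λ, ‖x‖ ≤ ‖x - a‖}

/-- The polar `{y | x · y ≤ 1 for all x ∈ C}`. -/
def polarBody (C : Set E) : Set E :=
  {y : E | ∀ x ∈ C, ⟪x, y⟫ ≤ 1}

end LatticeBodies

/-- The `d`-dimensional space of vectors in `ℝ^(d+1)` with coordinate sum zero, written as the
orthogonal complement of the all-ones vector, with the induced inner product. -/
abbrev SumZeroSpace (d : ℕ) : Type :=
  ↥((Submodule.span ℝ {WithLp.toLp 2 (fun _ : Fin (d + 1) => (1 : ℝ))})ᗮ :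
    Submodule ℝ (EuclideanSpace ℝ (Fin (d + 1))))

/-- The root lattice `A_d`: the integer vectors with coordinate sum zero, as a lattice in the
hyperplane that it spans. -/
def rootLatticeA (d : ℕ) : Submodule ℤ (SumZeroSpace d) where
  carrier := {x | ∀ i, ∃ n : ℤ, (x : EuclideanSpace ℝ (Fin (d + 1))) i = n}
  zero_mem' := fun _ => ⟨0, by simp⟩
  add_mem' := by
    intro x y hx hy i
    obtain ⟨m, hm⟩ := hx i
    obtain ⟨n, hn⟩ := hy i
    exact ⟨m + n, by simp [hm, hn]⟩
  smul_mem' := by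
    intro c x hx i
    obtain ⟨m, hm⟩ := hx i
    exact ⟨c * m, by simp [hm]⟩

/-! Both bounds count residues modulo 2. Let `C` be reduced. Every vertex is the only maximiser on
`C` of some width direction. Otherwise each width direction could be served by a point other than
that vertex, yet `C` is the convex hull of any such choice of points together with finitely many
interior points (`IsLatticeReduced.eq_convexHull`). Choose such a direction for each vertex. If the
directions `s`, `t` of two vertices are congruent modulo twice the dual lattice and `s ≠ -t`, then
`(s + t) / 2` is a non-zero dual vector, so `C` is at least as wide along it as along `s` and `t`;
hence its maximisers maximise `s` and `t` too, and the vertices coincide. So a residue class holds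
at most two vertices. The zero class holds none, since half a width direction would have smaller
width. This leaves `2 (2 ^ k - 1)`, where `k` enters by counting in the part of the lattice inside
the span of the directions.

For complete `C` the argument is dual. A diameter direction `v` has normals `u`, those of parallel
supporting hyperplanes at the ends of a longest segment (`IsDiametralNormal`). One arbitrary normal
per direction suffices to cut out `C` (`IsLatticeComplete.eq_polyhedron`), so each facet has a
diameter direction all of whose normals, up to sign, expose it. Directions with a non-zero lattice
vector as half-sum share a normal, so a class carries at most two facets; primitivity excludes the
zero class.

For sharpness, a Voronoi cell with a finite list of relevant vectors is complete and its polar is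
reduced (`IsVoronoiRelevant`). The relevant vectors of the dual of `A_d` are the projected
indicators of the `2 ^ (d + 1) - 2` non-empty proper subsets. Linear isomorphisms carry these
examples to every lattice. -/

set_option linter.unusedSectionVars false

/-! ### Counting residue classes modulo 2 -/

section Parity

variable {E : Type*} [NormedAddCommGroup E] [NormedSpace ℝ E] [FiniteDimensional ℝ E]

/-- A map into a free `ℤ`-module of rank `r` that avoids `2M` and whose fibres modulo `2M` have at
most two elements has a domain of at most `2 (2 ^ r - 1)` elements. -/
theorem encard_le_of_parity_free {M : Type*} [AddCommGroup M] [Module.Free ℤ M] [Module.Finite ℤ M]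
    {α : Type*} (X : Set α) (f : α → M) (h2 : ∀ x ∈ X, ∀ z : M, f x ≠ (2 : ℤ) • z)
    (h3 : ∀ x ∈ X, ∀ y ∈ X, ∀ z ∈ X, (∃ a : M, f x - f y = (2 : ℤ) • a) →
      (∃ a : M, f x - f z = (2 : ℤ) • a) → x = y ∨ x = z ∨ y = z) :
    X.encard ≤ ((2 ^ (Module.finrank ℤ M + 1) - 2 : ℕ) : ℕ∞) := by
  classical
  set r := Module.finrank ℤ M with hr
  let b := Module.finBasis ℤ M
  -- Coordinates modulo 2 identify `M / 2M` with `(ZMod 2) ^ r`.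
  let c : M → (Fin r → ZMod 2) := fun m i => ((b.repr m i : ℤ) : ZMod 2)
  have hsub : ∀ m n, c m = c n → ∃ a : M, m - n = (2 : ℤ) • a := by
    intro m n h
    have h' : ∀ i, ∃ k : ℤ, b.repr (m - n) i = 2 * k := by
      intro i
      have := congrFun h i
      simp only [c] at this
      rw [← sub_eq_zero, ← Int.cast_sub, ZMod.intCast_zmod_eq_zero_iff_dvd] at this
      obtain ⟨k, hk⟩ := this
      exact ⟨k, by simpa using hk⟩
    choose k hk using h'
    refine ⟨∑ i, k i • b i, ?_⟩
    conv_lhs => rw [← b.sum_repr (m - n)]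
    rw [Finset.smul_sum]
    refine Finset.sum_congr rfl fun i _ => ?_
    rw [hk i, mul_smul]
  have hc0 : c 0 = 0 := by ext i; simp [c]
  have hne : ∀ x ∈ X, c (f x) ≠ 0 := by
    intro x hx h
    obtain ⟨a, ha⟩ := hsub (f x) 0 (by rw [h, hc0])
    exact h2 x hx a (by simpa using ha)
  by_contra hlt
  rw [not_le] at hlt
  have hlt' := Order.add_one_le_of_lt hlt
  -- `X` may be infinite, so the pigeonhole is applied to a subset with exactly one element too
  -- many.
  obtain ⟨t, htX, ht⟩ := Set.exists_subset_encard_eq hlt'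
  have htfin : t.Finite := Set.finite_of_encard_eq_coe (k := 2 ^ (r + 1) - 2 + 1) (by
    rw [ht]; push_cast; rfl)
  have hcard : htfin.toFinset.card = 2 ^ (r + 1) - 2 + 1 := by
    have := htfin.encard_eq_coe_toFinset_card
    rw [ht] at this
    exact_mod_cast this.symm
  have himg : (htfin.toFinset.image fun x => c (f x)) ⊆ Finset.univ.erase 0 := by
    intro y hy
    obtain ⟨x, hx, rfl⟩ := Finset.mem_image.1 hy
    simpa using hne x (htX (by simpa using hx))
  have h1 := Finset.card_le_mul_card_image htfin.toFinset (f := fun x => c (f x)) 2 (by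
    intro y _
    by_contra hcon
    rw [not_le, Finset.two_lt_card] at hcon
    obtain ⟨p, hp, q, hq, s, hs, hpq, hps, hqs⟩ := hcon
    simp only [Finset.mem_filter, Set.Finite.mem_toFinset] at hp hq hs
    rcases h3 p (htX hp.1) q (htX hq.1) s (htX hs.1) (hsub _ _ (hp.2.trans hq.2.symm))
      (hsub _ _ (hp.2.trans hs.2.symm)) with h | h | h
    exacts [hpq h, hps h, hqs h])
  have h4 := Finset.card_le_card himg
  rw [Finset.card_erase_of_mem (Finset.mem_univ _)] at h4
  simp only [Finset.card_univ, Fintype.card_fun, ZMod.card, Fintype.card_fin] at h4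
  have h5 : 1 ≤ 2 ^ r := Nat.one_le_two_pow
  rw [pow_succ] at hcard
  omega

/-- The count takes place in `L ∩ span D`. This group is discrete, so its rank is the dimension of
its real span, at most that of `span D`. -/
theorem encard_le_of_parity (L : Submodule ℤ E) [DiscreteTopology L] {α : Type*} (X : Set α)
    (f : α → E) (D : Set E) (hf : ∀ x ∈ X, f x ∈ L) (hD : ∀ x ∈ X, f x ∈ D)
    (h2 : ∀ x ∈ X, ∀ z ∈ L, f x ≠ (2 : ℤ) • z)
    (h3 : ∀ x ∈ X, ∀ y ∈ X, ∀ z ∈ X, (∃ a ∈ L, f x - f y = (2 : ℤ) • a) →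
      (∃ a ∈ L, f x - f z = (2 : ℤ) • a) → x = y ∨ x = z ∨ y = z) :
    X.encard ≤
      ((2 ^ (Module.finrank ℝ (Submodule.span ℝ D) + 1) - 2 : ℕ) : ℕ∞) := by
  classical
  let M : Submodule ℤ E := L ⊓ (Submodule.span ℝ D).restrictScalars ℤ
  have hMd : DiscreteTopology M :=
    DiscreteTopology.of_subset (s := (L : Set E)) (t := (M : Set E)) ‹_› inf_le_left
  have hfM : ∀ x ∈ X, f x ∈ M := fun x hx => ⟨hf x hx, Submodule.subset_span (hD x hx)⟩
  have hrank : Module.finrank ℤ M ≤ Module.finrank ℝ (Submodule.span ℝ D) := by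
    have hd : DiscreteTopology (Submodule.span ℤ (M : Set E)) := by
      rw [Submodule.span_eq]; exact hMd
    have h := Real.finrank_eq_int_finrank_of_discrete hd
    rw [Set.finrank, Set.finrank, Submodule.span_eq] at h
    rw [← h]
    exact Submodule.finrank_mono (Submodule.span_le.2 fun x hx => hx.2)
  have key := encard_le_of_parity_free X (M := M) (fun x => if h : x ∈ X then ⟨f x, hfM x h⟩ else 0)
    (by
      intro x hx z hz
      simp only [hx, dif_pos] at hz
      exact h2 x hx z z.2.1 (by simpa using congrArg Subtype.val hz))
    (by
      intro x hx y hy z hz h h'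
      simp only [hx, hy, hz, dif_pos] at h h'
      obtain ⟨a, ha⟩ := h
      obtain ⟨a', ha'⟩ := h'
      exact h3 x hx y hy z hz ⟨a, a.2.1, by simpa using congrArg Subtype.val ha⟩
        ⟨a', a'.2.1, by simpa using congrArg Subtype.val ha'⟩)
  refine key.trans ?_
  have : 2 ^ (Module.finrank ℤ M + 1) ≤ 2 ^ (Module.finrank ℝ (Submodule.span ℝ D) + 1) :=
    Nat.pow_le_pow_right (by norm_num) (by omega)
  exact_mod_cast Nat.sub_le_sub_right this 2

end Parity

/-! ### Finiteness of bounded parts of a lattice -/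

section Discrete

variable {E : Type*} [NormedAddCommGroup E] [NormedSpace ℝ E] [FiniteDimensional ℝ E]

theorem finite_discrete_inter_norm_le (L : Submodule ℤ E) [DiscreteTopology L] (R : ℝ) :
    {x : E | x ∈ L ∧ ‖x‖ ≤ R}.Finite := by
  have : DiscreteTopology L.toAddSubgroup := ‹DiscreteTopology L›
  have h : IsClosed (L.toAddSubgroup : Set E) := AddSubgroup.isClosed_of_discrete
  have := Metric.finite_isBounded_inter_isClosed (s := (L : Set E)) (K := Metric.closedBall 0 R)
    DiscreteTopology.isDiscrete Metric.isBounded_closedBall h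
  refine this.subset ?_
  rintro x ⟨hx, hxR⟩
  exact ⟨by simpa using hxR, hx⟩

end Discrete

/-! ### The dual of a lattice is a lattice -/

section Dual
variable {E : Type*} [NormedAddCommGroup E] [InnerProductSpace ℝ E]

theorem innerₗ_nondegenerate : (innerₗ E : LinearMap.BilinForm ℝ E).Nondegenerate := by
  constructor
  · intro x hx
    exact inner_self_eq_zero.1 (hx x)
  · intro x hx
    exact inner_self_eq_zero.1 (hx x)

variable [FiniteDimensional ℝ E]

/-- The dual basis of a lattice basis generates the dual; discreteness and full rank of the dual are
read off from this. -/
theorem exists_dualLattice_eq_span (Λ : Submodule ℤ E) [DiscreteTopology Λ] [IsZLattice ℝ Λ] :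
    ∃ (ι : Type) (_ : Fintype ι) (b : Module.Basis ι ℝ E),
      dualLattice Λ = Submodule.span ℤ (Set.range b) := by
  classical
  have := ZLattice.module_free ℝ Λ
  have := ZLattice.module_finite ℝ Λ
  let b := (Module.finBasis ℤ Λ).ofZLatticeBasis ℝ Λ
  refine ⟨_, inferInstance, LinearMap.BilinForm.dualBasis (innerₗ E) innerₗ_nondegenerate b, ?_⟩
  have := LinearMap.BilinForm.dualSubmodule_span_of_basis (R := ℤ) (innerₗ E) innerₗ_nondegenerate b
  rw [← this, dualLattice]
  congr 1
  exact ((Module.finBasis ℤ Λ).ofZLatticeBasis_span ℝ Λ).symm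

instance dualLattice_discreteTopology (Λ : Submodule ℤ E) [DiscreteTopology Λ] [IsZLattice ℝ Λ] :
    DiscreteTopology (dualLattice Λ) := by
  obtain ⟨ι, _, b, h⟩ := exists_dualLattice_eq_span Λ
  rw [h]
  infer_instance

instance dualLattice_isZLattice (Λ : Submodule ℤ E) [DiscreteTopology Λ] [IsZLattice ℝ Λ] :
    IsZLattice ℝ (dualLattice Λ) := by
  obtain ⟨ι, _, b, h⟩ := exists_dualLattice_eq_span Λ
  constructor
  rw [h]
  exact eq_top_iff.2 (b.span_eq ▸ Submodule.span_mono Submodule.subset_span)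

end Dual

/-! ### Exposed faces and directional width -/

section Faces

variable {E : Type*} [NormedAddCommGroup E] [InnerProductSpace ℝ E]

/-- The face of `C` on which the linear functional `⟪u, ·⟫` is maximal. -/
def exposedFace (C : Set E) (u : E) : Set E :=
  {x | x ∈ C ∧ ∀ y ∈ C, ⟪u, y⟫ ≤ ⟪u, x⟫}

theorem exposedFace_nonempty {C : Set E} (hC : IsCompact C) (hne : C.Nonempty) (u : E) :
    (exposedFace C u).Nonempty := by
  obtain ⟨x, hx, h⟩ := hC.exists_isMaxOn hne (f := fun x => ⟪u, x⟫) (by fun_prop)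
  exact ⟨x, hx, fun y hy => h hy⟩

theorem IsConvexBody.nonempty {C : Set E} (hC : IsConvexBody C) : C.Nonempty :=
  hC.2.2.mono interior_subset

theorem IsConvexBody.exists_closedBall {C : Set E} (hC : IsConvexBody C) :
    ∃ c : E, ∃ r : ℝ, 0 < r ∧ Metric.closedBall c r ⊆ C := by
  obtain ⟨c, hc⟩ := hC.2.2
  obtain ⟨r, hr, h⟩ := Metric.nhds_basis_closedBall.mem_iff.1 (mem_interior_iff_mem_nhds.1 hc)
  exact ⟨c, r, hr, h⟩

theorem inner_sub_le_directionalWidth {C : Set E} (hC : IsCompact C) {a b : E} (ha : a ∈ C)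
    (hb : b ∈ C) (y : E) : ⟪y, a - b⟫ ≤ directionalWidth C y := by
  refine le_csSup ?_ ⟨a, ha, b, hb, rfl⟩
  obtain ⟨p, -, hp⟩ := exposedFace_nonempty hC ⟨a, ha⟩ y
  obtain ⟨q, -, hq⟩ := exposedFace_nonempty hC ⟨a, ha⟩ (-y)
  refine ⟨⟪y, p⟫ - ⟪y, q⟫, ?_⟩
  rintro _ ⟨a, ha, b, hb, rfl⟩
  have h1 := hp a ha
  have h2 := hq b hb
  simp only [inner_neg_left] at h2
  rw [inner_sub_right]
  linarith

theorem directionalWidth_le {C : Set E} (hne : C.Nonempty) {y : E} {W : ℝ}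
    (h : ∀ a ∈ C, ∀ b ∈ C, ⟪y, a - b⟫ ≤ W) : directionalWidth C y ≤ W := by
  obtain ⟨a, ha⟩ := hne
  refine csSup_le ⟨_, a, ha, a, ha, rfl⟩ ?_
  rintro _ ⟨a, ha, b, hb, rfl⟩
  exact h a ha b hb

theorem directionalWidth_eq_of_mem_exposedFace {C : Set E} (hC : IsCompact C) {a b y : E}
    (ha : a ∈ exposedFace C y) (hb : b ∈ exposedFace C (-y)) :
    directionalWidth C y = ⟪y, a - b⟫ := by
  refine le_antisymm (directionalWidth_le ⟨a, ha.1⟩ ?_)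
    (inner_sub_le_directionalWidth hC ha.1 hb.1 y)
  intro a' ha' b' hb'
  have h1 := ha.2 a' ha'
  have h2 := hb.2 b' hb'
  simp only [inner_neg_left] at h2
  rw [inner_sub_right, inner_sub_right]
  linarith

theorem exists_directionalWidth_eq {C : Set E} (hC : IsCompact C) (hne : C.Nonempty) (y : E) :
    ∃ a ∈ C, ∃ b ∈ C, directionalWidth C y = ⟪y, a - b⟫ := by
  obtain ⟨p, hp⟩ := exposedFace_nonempty hC hne y
  obtain ⟨q, hq⟩ := exposedFace_nonempty hC hne (-y)
  exact ⟨p, hp.1, q, hq.1, directionalWidth_eq_of_mem_exposedFace hC hp hq⟩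

theorem directionalWidth_nonneg {C : Set E} (hC : IsCompact C) (hne : C.Nonempty) (y : E) :
    0 ≤ directionalWidth C y := by
  obtain ⟨a, ha⟩ := hne
  simpa using inner_sub_le_directionalWidth hC ha ha y

theorem directionalWidth_neg {C : Set E} (y : E) :
    directionalWidth C (-y) = directionalWidth C y := by
  unfold directionalWidth
  congr 1
  ext r
  constructor <;>
  · rintro ⟨a, ha, b, hb, rfl⟩
    exact ⟨b, hb, a, ha, by simp only [inner_neg_left, inner_sub_right]; ring⟩

/-- The width grows linearly with `‖y‖`, so only finitely many dual vectors can compete for the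
lattice width. -/
theorem mul_norm_le_directionalWidth {C : Set E} (hC : IsCompact C) {c : E} {r : ℝ} (hr : 0 ≤ r)
    (h : Metric.closedBall c r ⊆ C) (y : E) : r * ‖y‖ ≤ directionalWidth C y := by
  rcases eq_or_ne y 0 with rfl | hy
  · simpa using directionalWidth_nonneg hC ⟨c, h (by simpa using hr)⟩ 0
  have hy' : ‖y‖ ≠ 0 := norm_ne_zero_iff.2 hy
  have h1 : c + (r / ‖y‖) • y ∈ C := h (by
    rw [mem_closedBall_iff_norm, add_sub_cancel_left, norm_smul, norm_div, norm_norm,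
      div_mul_cancel₀ _ hy', Real.norm_of_nonneg hr])
  have h2 := inner_sub_le_directionalWidth hC h1 (h (Metric.mem_closedBall_self hr)) y
  rw [add_sub_cancel_left, inner_smul_right, real_inner_self_eq_norm_sq] at h2
  calc r * ‖y‖ = r / ‖y‖ * ‖y‖ ^ 2 := by field_simp
    _ ≤ _ := h2

theorem latticeWidth_le_directionalWidth {Λ : Submodule ℤ E} {C : Set E} (hC : IsCompact C)
    (hne : C.Nonempty) {y : E} (hy : y ∈ dualLattice Λ) (hy0 : y ≠ 0) :
    latticeWidth Λ C ≤ directionalWidth C y :=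
  csInf_le ⟨0, by rintro _ ⟨y, -, -, rfl⟩; exact directionalWidth_nonneg hC hne y⟩
    ⟨y, hy, hy0, rfl⟩

theorem directionalWidth_mono {C C' : Set E} (hC : IsCompact C) (hne : C'.Nonempty) (h : C' ⊆ C)
    (y : E) : directionalWidth C' y ≤ directionalWidth C y :=
  directionalWidth_le hne fun _ ha _ hb => inner_sub_le_directionalWidth hC (h ha) (h hb) y

theorem not_mem_interior_of_mem_extremePoints [Nontrivial E] {C : Set E} {p : E}
    (hp : p ∈ C.extremePoints ℝ) : p ∉ interior C := by
  intro hi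
  obtain ⟨v, hv⟩ := exists_ne (0 : E)
  obtain ⟨r, hr, h⟩ := Metric.nhds_basis_closedBall.mem_iff.1 (mem_interior_iff_mem_nhds.1 hi)
  have hv' : ‖v‖ ≠ 0 := norm_ne_zero_iff.2 hv
  have hnorm : ‖(r / ‖v‖) • v‖ ≤ r := by
    rw [norm_smul, norm_div, norm_norm, div_mul_cancel₀ _ hv', Real.norm_of_nonneg hr.le]
  have h1 : p + (r / ‖v‖) • v ∈ C := h (by simpa [mem_closedBall_iff_norm] using hnorm)
  have h2 : p - (r / ‖v‖) • v ∈ C := h (by simpa [mem_closedBall_iff_norm] using hnorm)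
  have h3 := hp.2 h1 h2 ⟨1 / 2, 1 / 2, by norm_num, by norm_num, by norm_num, by module⟩
  have : (r / ‖v‖) • v = 0 := by simpa using h3
  rcases smul_eq_zero.1 this with h | h
  · exact (div_ne_zero hr.ne' hv') h
  · exact hv h

end Faces

/-! ### Reduced bodies: the vertex bound -/

section Reduced

variable {E : Type*} [NormedAddCommGroup E] [InnerProductSpace ℝ E] [FiniteDimensional ℝ E]

theorem latticeWidth_eq_of_subset {Λ : Submodule ℤ E} {C C' : Set E} (hC : IsCompact C)
    (hC' : IsCompact C') (hne : C'.Nonempty) (hsub : C' ⊆ C)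
    (h : ∀ y ∈ dualLattice Λ, y ≠ 0 → latticeWidth Λ C ≤ directionalWidth C' y) :
    latticeWidth Λ C' = latticeWidth Λ C := by
  by_cases hL : ∃ y ∈ dualLattice Λ, y ≠ 0
  · obtain ⟨y, hy, hy0⟩ := hL
    apply le_antisymm
    · refine le_csInf ⟨_, y, hy, hy0, rfl⟩ ?_
      rintro _ ⟨z, hz, hz0, rfl⟩
      exact (latticeWidth_le_directionalWidth hC' hne hz hz0).trans
        (directionalWidth_mono hC hne hsub z)
    · refine le_csInf ⟨_, y, hy, hy0, rfl⟩ ?_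
      rintro _ ⟨z, hz, hz0, rfl⟩
      exact h z hz hz0
  -- If the dual lattice is zero, both widths are the infimum of the empty set.
  · push Not at hL
    have : ∀ K : Set E, {r : ℝ | ∃ y ∈ dualLattice Λ, y ≠ 0 ∧ r = directionalWidth K y} = ∅ := by
      intro K
      ext r
      simp only [Set.mem_ofPred_eq, Set.mem_empty_iff_false, iff_false]
      rintro ⟨y, hy, hy0, -⟩
      exact hy0 (hL y hy)
    rw [latticeWidth, latticeWidth, this, this]

/-- A segment attaining the width `W` is shrunk by the factor `w / W < 1` towards an interior point.
Directions wider than the minimum are thus served by interior points. -/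
theorem exists_interior_inner_sub_eq {C : Set E} (hC : IsConvexBody C) {y : E} {w : ℝ}
    (hw : 0 ≤ w) (h : w < directionalWidth C y) :
    ∃ a ∈ interior C, ∃ b ∈ interior C, ⟪y, a - b⟫ = w := by
  obtain ⟨c, hc⟩ := hC.2.2
  obtain ⟨a, ha, b, hb, hab⟩ := exists_directionalWidth_eq hC.2.1 hC.nonempty y
  set W := directionalWidth C y
  have hW : 0 < W := hw.trans_lt h
  have h1 : 0 < (W - w) / W := div_pos (by linarith) hW
  have h2 : (W - w) / W + w / W = 1 := by field_simp; ring
  have h3 : 0 ≤ w / W := by positivity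
  refine ⟨((W - w) / W) • c + (w / W) • a, ?_, ((W - w) / W) • c + (w / W) • b, ?_, ?_⟩
  · exact hC.1.combo_interior_self_mem_interior hc ha h1 h3 h2
  · exact hC.1.combo_interior_self_mem_interior hc hb h1 h3 h2
  · rw [add_sub_add_left_eq_sub, ← smul_sub, inner_smul_right, ← hab]
    field_simp

theorem widthDirections_finite {Λ : Submodule ℤ E} [DiscreteTopology (dualLattice Λ)]
    {C : Set E} (hC : IsConvexBody C) : (widthDirections Λ C).Finite := by
  obtain ⟨c, r, hr, hball⟩ := hC.exists_closedBall
  refine (finite_discrete_inter_norm_le (dualLattice Λ) (latticeWidth Λ C / r)).subset ?_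
  rintro y ⟨hy, -, hw⟩
  refine ⟨hy, ?_⟩
  rw [le_div_iff₀ hr, mul_comm, ← hw]
  exact mul_norm_le_directionalWidth hC.2.1 hr.le hball y

theorem neg_mem_widthDirections {Λ : Submodule ℤ E} {C : Set E} {y : E}
    (hy : y ∈ widthDirections Λ C) : -y ∈ widthDirections Λ C :=
  ⟨neg_mem hy.1, neg_ne_zero.2 hy.2.1, by rw [directionalWidth_neg, hy.2.2]⟩

theorem exists_finite_interior_convexHull_nonempty {U : Set E} (hU : IsOpen U)
    (hne : U.Nonempty) :
    ∃ T : Set E, T.Finite ∧ T ⊆ U ∧ (interior (convexHull ℝ T)).Nonempty := by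
  obtain ⟨x, hx⟩ := hne
  obtain ⟨b, hb, hbU⟩ := exists_mem_interior_convexHull_affineBasis (hU.mem_nhds hx)
  exact ⟨Set.range b, Set.finite_range _, (subset_convexHull ℝ _).trans hbU, x, hb⟩

/-- The hull keeps the lattice width. For a width direction `y`, the points `a y` and `a (-y)`
realise its width; the finitely many other short dual vectors are served by interior pairs; long
ones are wide enough because of a ball inside the hull. Reducedness then forces equality. The
freedom in `a` is what the next lemma exploits. -/
theorem IsLatticeReduced.eq_convexHull {Λ : Submodule ℤ E} [DiscreteTopology (dualLattice Λ)]
    {C : Set E} (hC : IsLatticeReduced Λ C) (a : E → E)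
    (ha : ∀ y ∈ widthDirections Λ C, a y ∈ exposedFace C y) :
    ∃ T : Set E, T.Finite ∧ T ⊆ interior C ∧
      C = convexHull ℝ (T ∪ a '' widthDirections Λ C) := by
  classical
  obtain ⟨hb, hmin⟩ := hC
  set w := latticeWidth Λ C with hw
  have hw0 : 0 ≤ w := Real.sInf_nonneg (by
    rintro _ ⟨y, -, -, rfl⟩; exact directionalWidth_nonneg hb.2.1 hb.nonempty y)
  obtain ⟨T₀, hT₀, hT₀C, c, hc⟩ := exists_finite_interior_convexHull_nonempty isOpen_interior hb.2.2
  obtain ⟨r, hr, hball⟩ := Metric.nhds_basis_closedBall.mem_iff.1 (mem_interior_iff_mem_nhds.1 hc)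
  -- Beyond norm `w / r`, the ball of radius `r` in the hull of `T₀` already has width more than
  -- `w`.
  let S : Set E := {y | y ∈ dualLattice Λ ∧ ‖y‖ ≤ w / r}
  have hS : S.Finite := finite_discrete_inter_norm_le _ _
  have hsel : ∀ y : E, ∃ p : E × E, p.1 ∈ interior C ∧ p.2 ∈ interior C ∧
      (w < directionalWidth C y → ⟪y, p.1 - p.2⟫ = w) := by
    intro y
    by_cases h : w < directionalWidth C y
    · obtain ⟨p, hp, q, hq, h⟩ := exists_interior_inner_sub_eq hb hw0 h
      exact ⟨(p, q), hp, hq, fun _ => h⟩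
    · obtain ⟨c, hc⟩ := hb.2.2
      exact ⟨(c, c), hc, hc, fun h' => (h h').elim⟩
  choose p hp1 hp2 hp using hsel
  let T : Set E := T₀ ∪ ((fun y => (p y).1) '' S ∪ (fun y => (p y).2) '' S)
  have hT : T.Finite := hT₀.union ((hS.image _).union (hS.image _))
  have hTC : T ⊆ interior C := by
    rintro x (hx | ⟨y, -, rfl⟩ | ⟨y, -, rfl⟩)
    exacts [hT₀C hx, hp1 y, hp2 y]
  refine ⟨T, hT, hTC, ?_⟩
  set A := T ∪ a '' widthDirections Λ C
  have hA : A.Finite := hT.union ((widthDirections_finite hb).image _)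
  have hAC : A ⊆ C := by
    rintro x (hx | ⟨y, hy, rfl⟩)
    exacts [interior_subset (hTC hx), (ha y hy).1]
  have hsub : convexHull ℝ A ⊆ C := convexHull_min hAC hb.1
  have hAc : IsCompact (convexHull ℝ A) := hA.isCompact_convexHull ℝ
  have hT₀A : convexHull ℝ T₀ ⊆ convexHull ℝ A :=
    convexHull_mono (Set.subset_union_left.trans Set.subset_union_left)
  have hbody : IsConvexBody (convexHull ℝ A) :=
    ⟨convex_convexHull ℝ A, hAc, c, interior_mono hT₀A hc⟩
  have hmem : ∀ x ∈ A, x ∈ convexHull ℝ A := fun x hx => subset_convexHull ℝ A hx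
  have hwidth : latticeWidth Λ (convexHull ℝ A) = latticeWidth Λ C := by
    refine latticeWidth_eq_of_subset hb.2.1 hAc hbody.nonempty hsub ?_
    intro y hy hy0
    by_cases hyD : directionalWidth C y = w
    · have hD : y ∈ widthDirections Λ C := ⟨hy, hy0, hyD⟩
      have hD' := neg_mem_widthDirections hD
      rw [← hw, ← hyD, directionalWidth_eq_of_mem_exposedFace hb.2.1 (ha y hD) (ha _ hD')]
      exact inner_sub_le_directionalWidth hAc (hmem _ (Or.inr ⟨_, hD, rfl⟩))
        (hmem _ (Or.inr ⟨_, hD', rfl⟩)) y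
    · have hlt : w < directionalWidth C y :=
        lt_of_le_of_ne (latticeWidth_le_directionalWidth hb.2.1 hb.nonempty hy hy0) (Ne.symm hyD)
      by_cases hyS : ‖y‖ ≤ w / r
      · rw [← hw, ← hp y hlt]
        exact inner_sub_le_directionalWidth hAc
          (hmem _ (Or.inl (Or.inr (Or.inl ⟨y, ⟨hy, hyS⟩, rfl⟩))))
          (hmem _ (Or.inl (Or.inr (Or.inr ⟨y, ⟨hy, hyS⟩, rfl⟩)))) y
      · rw [not_le, div_lt_iff₀ hr, mul_comm] at hyS
        exact hyS.le.trans (mul_norm_le_directionalWidth hAc hr.le (hball.trans hT₀A) y)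
  by_contra hne
  exact hmin ⟨_, hbody, hsub.ssubset_of_ne (Ne.symm hne), hwidth⟩

/-- Otherwise all the maximisers can be chosen different from `p`. Then `p`, an extreme point of the
hull, is one of the generating interior points, which is impossible. -/
theorem IsLatticeReduced.exists_exposedFace_eq [Nontrivial E] {Λ : Submodule ℤ E}
    [DiscreteTopology (dualLattice Λ)] {C : Set E} (hC : IsLatticeReduced Λ C) {p : E}
    (hp : p ∈ C.extremePoints ℝ) :
    ∃ y ∈ widthDirections Λ C, ∀ x ∈ exposedFace C y, x = p := by
  by_contra! h
  choose! a ha hap using h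
  obtain ⟨T, -, hTC, hCeq⟩ := hC.eq_convexHull a ha
  rw [hCeq] at hp
  rcases extremePoints_convexHull_subset hp with hT | ⟨y, hy, hyp⟩
  · rw [← hCeq] at hp
    exact not_mem_interior_of_mem_extremePoints hp (hTC hT)
  · exact hap y hy hyp

theorem IsLatticeReduced.isPolytope {Λ : Submodule ℤ E} [DiscreteTopology (dualLattice Λ)]
    {C : Set E} (hC : IsLatticeReduced Λ C) : IsPolytope C := by
  choose a ha using exposedFace_nonempty hC.1.2.1 hC.1.nonempty
  obtain ⟨T, hT, -, hCeq⟩ := hC.eq_convexHull a fun y _ => ha y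
  exact ⟨_, hT.union ((widthDirections_finite hC.1).image _), hCeq⟩

theorem latticeWidth_pos_of_mem_widthDirections {Λ : Submodule ℤ E} {C : Set E}
    (hC : IsConvexBody C) {y : E} (hy : y ∈ widthDirections Λ C) : 0 < latticeWidth Λ C := by
  obtain ⟨c, r, hr, hball⟩ := hC.exists_closedBall
  rw [← hy.2.2]
  exact (mul_pos hr (norm_pos_iff.2 hy.2.1)).trans_le
    (mul_norm_le_directionalWidth hC.2.1 hr.le hball y)

theorem directionalWidth_two_smul {C : Set E} (hC : IsCompact C) (hne : C.Nonempty) (y : E) :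
    2 * directionalWidth C y ≤ directionalWidth C ((2 : ℤ) • y) := by
  obtain ⟨a, ha, b, hb, h⟩ := exists_directionalWidth_eq hC hne y
  have := inner_sub_le_directionalWidth hC ha hb ((2 : ℤ) • y)
  rw [two_smul, inner_add_left] at this
  rw [two_smul]
  linarith

/-- Width directions whose half-sum is a non-zero dual lattice vector have a common maximiser. -/
theorem exists_mem_exposedFace_of_add_eq {Λ : Submodule ℤ E} {C : Set E} (hC : IsConvexBody C)
    {s t z : E} (hs : s ∈ widthDirections Λ C) (ht : t ∈ widthDirections Λ C)
    (hz : z ∈ dualLattice Λ) (hz0 : z ≠ 0) (h : s + t = (2 : ℤ) • z) :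
    ∃ a, a ∈ exposedFace C s ∧ a ∈ exposedFace C t := by
  obtain ⟨a, ha, b, hb, hab⟩ := exists_directionalWidth_eq hC.2.1 hC.nonempty z
  have h1 := latticeWidth_le_directionalWidth hC.2.1 hC.nonempty hz hz0
  have key : ∀ x ∈ C, ⟪s, x - b⟫ ≤ latticeWidth Λ C ∧ ⟪t, x - b⟫ ≤ latticeWidth Λ C := by
    intro x hx
    constructor
    · rw [← hs.2.2]; exact inner_sub_le_directionalWidth hC.2.1 hx hb s
    · rw [← ht.2.2]; exact inner_sub_le_directionalWidth hC.2.1 hx hb t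
  -- The right side is at least twice the lattice width and each summand on the left is at most the
  -- lattice width, so all are equalities and `a` maximises both `s` and `t`.
  have h2 : ⟪s, a - b⟫ + ⟪t, a - b⟫ = 2 * ⟪z, a - b⟫ := by
    rw [← inner_add_left, h, two_smul, inner_add_left]; ring
  have h3 := key a ha
  simp only [inner_sub_right] at *
  refine ⟨a, ⟨ha, fun x hx => ?_⟩, ha, fun x hx => ?_⟩ <;>
  · have := key x hx
    linarith

theorem IsLatticeReduced.encard_vertices_le [Nontrivial E] {Λ : Submodule ℤ E}
    [DiscreteTopology (dualLattice Λ)] {C : Set E} (hC : IsLatticeReduced Λ C) :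
    (polytopeVertices C).encard ≤ ((2 ^ (Module.finrank ℝ
      (Submodule.span ℝ (widthDirections Λ C)) + 1) - 2 : ℕ) : ℕ∞) := by
  have h := fun p (hp : p ∈ C.extremePoints ℝ) => hC.exists_exposedFace_eq hp
  choose! y hy hyp using h
  have hpair : ∀ p ∈ C.extremePoints ℝ, ∀ q ∈ C.extremePoints ℝ,
      (∃ a ∈ dualLattice Λ, y p - y q = (2 : ℤ) • a) → p = q ∨ y p = - y q := by
    rintro p hp q hq ⟨a, ha, hpq⟩
    -- `a + y q` is the half-sum of `y p` and `y q`. If it vanishes they are opposite; if not, a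
    -- common maximiser identifies `p` and `q`.
    by_cases hz : a + y q = 0
    · right
      have : a = - y q := eq_neg_of_add_eq_zero_left hz
      rw [this, sub_eq_iff_eq_add, two_smul] at hpq
      rw [hpq]; abel
    · left
      obtain ⟨x, hx1, hx2⟩ := exists_mem_exposedFace_of_add_eq hC.1 (hy p hp) (hy q hq)
        (add_mem ha (hy q hq).1) hz (by
          rw [sub_eq_iff_eq_add] at hpq
          rw [hpq, smul_add, two_smul ℤ (y q)]; abel)
      rw [← hyp p hp x hx1, hyp q hq x hx2]
  have hinj : ∀ p ∈ C.extremePoints ℝ, ∀ q ∈ C.extremePoints ℝ, y p = y q → p = q := by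
    intro p hp q hq h
    obtain ⟨x, hx⟩ := exposedFace_nonempty hC.1.2.1 hC.1.nonempty (y p)
    rw [← hyp p hp x hx, hyp q hq x (h ▸ hx)]
  refine encard_le_of_parity (dualLattice Λ) (C.extremePoints ℝ) y (widthDirections Λ C)
    (fun p hp => (hy p hp).1) hy ?_ ?_
  · intro p hp z hz h
    have hD := hy p hp
    have hz0 : z ≠ 0 := by
      rintro rfl
      exact hD.2.1 (by simpa using h)
    have h1 := latticeWidth_le_directionalWidth hC.1.2.1 hC.1.nonempty hz hz0
    have h2 := directionalWidth_two_smul hC.1.2.1 hC.1.nonempty z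
    rw [← h, hD.2.2] at h2
    have := latticeWidth_pos_of_mem_widthDirections hC.1 hD
    linarith
  -- In a class of three, `q` and `s` would both have the direction `-y p`, and a direction
  -- determines its vertex.
  · intro p hp q hq s hs h1 h2
    rcases hpair p hp q hq h1 with h | h
    · exact Or.inl h
    rcases hpair p hp s hs h2 with h' | h'
    · exact Or.inr (Or.inl h')
    · exact Or.inr (Or.inr (hinj q hq s hs (neg_injective (h.symm.trans h'))))

end Reduced

/-! ### Polyhedra, facets and their normals -/

section Polyhedra

variable {E : Type*} [NormedAddCommGroup E] [InnerProductSpace ℝ E]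

/-- The polyhedron of all `x` with `⟪u, x⟫ ≤ h u` for `u ∈ U`. -/
def polyhedron (U : Set E) (h : E → ℝ) : Set E :=
  {x | ∀ u ∈ U, ⟪u, x⟫ ≤ h u}

theorem convex_polyhedron (U : Set E) (h : E → ℝ) : Convex ℝ (polyhedron U h) := by
  intro x hx y hy a b ha hb hab u hu
  rw [inner_add_right, inner_smul_right, inner_smul_right]
  calc a * ⟪u, x⟫ + b * ⟪u, y⟫ ≤ a * h u + b * h u := by
        gcongr
        exacts [hx u hu, hy u hu]
    _ = h u := by rw [← add_mul, hab, one_mul]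

theorem isClosed_polyhedron (U : Set E) (h : E → ℝ) : IsClosed (polyhedron U h) := by
  have : polyhedron U h = ⋂ u ∈ U, {x | ⟪u, x⟫ ≤ h u} := by
    ext x; simp [polyhedron]
  rw [this]
  exact isClosed_biInter fun u _ => isClosed_le (by fun_prop) (by fun_prop)

/-- Moving from a point of a polyhedron in a direction that preserves all tight inequalities
stays in the polyhedron for a short while. -/
theorem exists_pos_forall_add_smul_mem_polyhedron {U : Set E} (hU : U.Finite) {h : E → ℝ} {x v : E}
    (hx : x ∈ polyhedron U h) (hv : ∀ u ∈ U, ⟪u, x⟫ = h u → ⟪u, v⟫ ≤ 0) :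
    ∃ ε : ℝ, 0 < ε ∧ x + ε • v ∈ polyhedron U h := by
  have hev : ∀ u ∈ U, ∀ᶠ ε : ℝ in nhdsWithin 0 (Set.Ioi 0), ⟪u, x + ε • v⟫ ≤ h u := by
    intro u hu
    rcases (hx u hu).lt_or_eq with hlt | heq
    · have hcont : Continuous fun ε : ℝ => ⟪u, x + ε • v⟫ := by fun_prop
      have : ∀ᶠ ε : ℝ in nhds 0, ⟪u, x + ε • v⟫ < h u :=
        hcont.continuousAt.eventually_lt continuousAt_const (by simpa using hlt)
      exact (this.filter_mono nhdsWithin_le_nhds).mono fun _ h => h.le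
    · filter_upwards [self_mem_nhdsWithin] with ε hε
      rw [inner_add_right, inner_smul_right, heq]
      have := mul_nonpos_of_nonneg_of_nonpos (le_of_lt (Set.mem_Ioi.1 hε)) (hv u hu heq)
      linarith
  have hall := (Filter.eventually_all_finite hU).2 hev
  obtain ⟨ε, h1, h2⟩ := (hall.and self_mem_nhdsWithin).exists
  exact ⟨ε, h2, h1⟩

theorem mem_openSegment_add_smul_sub (x y : E) {ε : ℝ} (hε : 0 < ε) :
    x ∈ openSegment ℝ y (x + ε • (x - y)) := by
  refine ⟨ε / (1 + ε), 1 / (1 + ε), by positivity, by positivity, by field_simp; ring, ?_⟩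
  match_scalars
  · field_simp; ring
  · field_simp

/-- An extreme point is determined by its set of tight constraints: if `x` and `y` share theirs, the
segment from `y` to `x` can be prolonged beyond `x`. -/
theorem extremePoints_polyhedron_finite {U : Set E} (hU : U.Finite) (h : E → ℝ) :
    ((polyhedron U h).extremePoints ℝ).Finite := by
  refine Set.Finite.of_finite_image (f := fun x => {u | u ∈ U ∧ ⟪u, x⟫ = h u})
    (hU.finite_subsets.subset ?_) ?_
  · rintro _ ⟨x, -, rfl⟩
    exact fun u hu => hu.1
  · intro x hx y hy hxy
    have hmem : ∀ u ∈ U, (⟪u, x⟫ = h u ↔ ⟪u, y⟫ = h u) := by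
      intro u hu
      have := Set.ext_iff.1 hxy u
      exact ⟨fun e => (this.1 ⟨hu, e⟩).2, fun e => (this.2 ⟨hu, e⟩).2⟩
    obtain ⟨ε, hε, hmemε⟩ := exists_pos_forall_add_smul_mem_polyhedron hU hx.1 (v := x - y) (by
      intro u hu e
      rw [inner_sub_right, e, (hmem u hu).1 e, sub_self])
    exact (hx.2 hy.1 hmemε (mem_openSegment_add_smul_sub x y hε)).symm

theorem isPolytope_of_eq_polyhedron {C U : Set E} (hU : U.Finite) {h : E → ℝ}
    (hC : IsCompact C) (hCU : C = polyhedron U h) : IsPolytope C := by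
  have hfin : (C.extremePoints ℝ).Finite := hCU ▸ extremePoints_polyhedron_finite hU h
  refine ⟨_, hfin, ?_⟩
  have := closure_convexHull_extremePoints hC (hCU ▸ convex_polyhedron U h)
  rwa [(hfin.isClosed_convexHull ℝ).closure_eq, eq_comm] at this

/-- Averaging a strict witness for each constraint gives one point strict for all. -/
theorem exists_forall_lt_of_convex {U : Set E} (hU : U.Finite) {h : E → ℝ} {F : Set E}
    (hF : Convex ℝ F) (hne : F.Nonempty) (hle : ∀ x ∈ F, ∀ u ∈ U, ⟪u, x⟫ ≤ h u)
    (hlt : ∀ u ∈ U, ∃ x ∈ F, ⟪u, x⟫ < h u) : ∃ x ∈ F, ∀ u ∈ U, ⟪u, x⟫ < h u := by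
  induction U, hU using Set.Finite.induction_on with
  | empty => exact ⟨hne.some, hne.some_mem, by simp⟩
  | @insert u U _ _ ih =>
    obtain ⟨x, hx, hxU⟩ := ih (fun x hx v hv => hle x hx v (Or.inr hv))
      (fun v hv => hlt v (Or.inr hv))
    obtain ⟨y, hy, hyu⟩ := hlt u (Or.inl rfl)
    refine ⟨(1 / 2 : ℝ) • x + (1 / 2 : ℝ) • y, hF hx hy (by norm_num) (by norm_num) (by norm_num),
      ?_⟩
    rintro v (rfl | hv) <;> rw [inner_add_right, inner_smul_right, inner_smul_right]
    · have := hle x hx v (Or.inl rfl)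
      linarith
    · have := hle y hy v (Or.inr hv)
      have := hxU v hv
      linarith

theorem mem_interior_polyhedron {U : Set E} (hU : U.Finite) {h : E → ℝ} {x : E}
    (hx : ∀ u ∈ U, ⟪u, x⟫ < h u) : x ∈ interior (polyhedron U h) := by
  rw [mem_interior_iff_mem_nhds]
  have : ∀ᶠ y in nhds x, ∀ u ∈ U, ⟪u, y⟫ < h u := by
    refine (Filter.eventually_all_finite hU).2 fun u hu => ?_
    have hcont : Continuous fun y : E => ⟪u, y⟫ := by fun_prop
    exact hcont.continuousAt.eventually_lt continuousAt_const (hx u hu)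
  exact this.mono fun y hy u hu => (hy u hu).le

theorem eq_of_isExtreme_of_mem_interior {C F : Set E} (hF : IsExtreme ℝ C F) {x : E}
    (hx : x ∈ F) (hxi : x ∈ interior C) : F = C := by
  refine hF.1.antisymm fun y hy => ?_
  have hcont : Continuous fun ε : ℝ => x + ε • (x - y) := by fun_prop
  have hev : ∀ᶠ ε : ℝ in nhds 0, x + ε • (x - y) ∈ C :=
    hcont.continuousAt.eventually_mem (by simpa using mem_interior_iff_mem_nhds.1 hxi)
  obtain ⟨ε, h1, h2⟩ := ((hev.filter_mono nhdsWithin_le_nhds).and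
    (self_mem_nhdsWithin (s := Set.Ioi (0 : ℝ)))).exists
  exact hF.2 hy h1 hx (mem_openSegment_add_smul_sub x y h2)

theorem vectorSpan_eq_top_of_interior_nonempty {C : Set E} (hC : (interior C).Nonempty) :
    vectorSpan ℝ C = ⊤ := by
  have h := isOpen_interior.affineSpan_eq_top hC
  have h' : affineSpan ℝ C = ⊤ := top_le_iff.1 (h ▸ affineSpan_mono ℝ interior_subset)
  rw [← direction_affineSpan, h', AffineSubspace.direction_top]

/-- If no constraint is tight on all of `F`, some point of `F` is strict for every constraint, hence
interior to `C`; an extreme subset with an interior point is all of `C`, against the dimension of a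
facet. -/
theorem exists_subset_exposedFace_of_mem_polytopeFacets {C U : Set E} [FiniteDimensional ℝ E]
    (hU : U.Finite) {h : E → ℝ} (hCU : C = polyhedron U h)
    {F : Set E} (hF : F ∈ polytopeFacets C) :
    ∃ u ∈ U, F ⊆ exposedFace C u := by
  by_contra! hcon
  have hsub : ∀ x ∈ C, ∀ u ∈ U, ⟪u, x⟫ ≤ h u := fun x hx u hu => by rw [hCU] at hx; exact hx u hu
  obtain ⟨x, hx, hxU⟩ := exists_forall_lt_of_convex hU (h := h) hF.2.1 hF.1
    (fun x hx => hsub x (hF.2.2.1.1 hx)) (by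
      intro u hu
      obtain ⟨x, hx, hxu⟩ := Set.not_subset.1 (hcon u hu)
      refine ⟨x, hx, lt_of_not_ge fun hge => hxu ⟨hF.2.2.1.1 hx, fun y hy => ?_⟩⟩
      exact (hsub y hy u hu).trans hge)
  have hxi := mem_interior_polyhedron hU hxU
  rw [← hCU] at hxi
  have := eq_of_isExtreme_of_mem_interior hF.2.2.1 hx hxi
  have h2 := hF.2.2.2
  rw [this] at h2
  omega

theorem convex_exposedFace {C : Set E} (hC : Convex ℝ C) (u : E) : Convex ℝ (exposedFace C u) := by
  intro x hx y hy a b ha hb hab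
  refine ⟨hC hx.1 hy.1 ha hb hab, fun z hz => ?_⟩
  rw [inner_add_right, inner_smul_right, inner_smul_right]
  have h1 := mul_le_mul_of_nonneg_left (hx.2 z hz) ha
  have h2 := mul_le_mul_of_nonneg_left (hy.2 z hz) hb
  have h3 : a * ⟪u, z⟫ + b * ⟪u, z⟫ = ⟪u, z⟫ := by rw [← add_mul, hab, one_mul]
  linarith

theorem isExtreme_exposedFace (C : Set E) (u : E) : IsExtreme ℝ C (exposedFace C u) := by
  refine ⟨fun x hx => hx.1, ?_⟩
  rintro x hx y hy z hz ⟨a, b, ha, hb, hab, rfl⟩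
  refine ⟨hx, fun w hw => (hz.2 w hw).trans ?_⟩
  have h1 := hz.2 y hy
  rw [inner_add_right, inner_smul_right, inner_smul_right] at h1 ⊢
  obtain rfl : a = 1 - b := by linarith
  have h2 : ⟪u, y⟫ ≤ ⟪u, x⟫ := by
    by_contra hlt
    nlinarith
  nlinarith

theorem vectorSpan_exposedFace_le {C : Set E} (u : E) :
    vectorSpan ℝ (exposedFace C u) ≤ (Submodule.span ℝ {u})ᗮ := by
  rw [vectorSpan, Submodule.span_le]
  rintro _ ⟨x, hx, y, hy, rfl⟩
  rw [SetLike.mem_coe, Submodule.mem_orthogonal_singleton_iff_inner_right]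
  change ⟪u, x - y⟫ = 0
  rw [inner_sub_right, sub_eq_zero]
  exact le_antisymm (hy.2 x hx.1) (hx.2 y hy.1)

theorem finrank_orthogonal_singleton_add_one [FiniteDimensional ℝ E] {u : E} (hu : u ≠ 0) :
    Module.finrank ℝ (Submodule.span ℝ {u})ᗮ + 1 = Module.finrank ℝ E := by
  have := Submodule.finrank_add_finrank_orthogonal (Submodule.span ℝ {u})
  rw [finrank_span_singleton hu] at this
  omega

theorem vectorSpan_eq_orthogonal_of_mem_polytopeFacets [FiniteDimensional ℝ E] {C F : Set E}
    (hC : IsConvexBody C) (hF : F ∈ polytopeFacets C) {u : E} (hu : u ≠ 0)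
    (hFu : F ⊆ exposedFace C u) : vectorSpan ℝ F = (Submodule.span ℝ {u})ᗮ := by
  refine Submodule.eq_of_le_of_finrank_eq
    ((vectorSpan_mono ℝ hFu).trans (vectorSpan_exposedFace_le u)) ?_
  have h1 := hF.2.2.2
  rw [vectorSpan_eq_top_of_interior_nonempty hC.2.2, finrank_top] at h1
  have h2 := finrank_orthogonal_singleton_add_one hu
  omega

/-- By dimension, `F` spans the supporting hyperplane. From any `z` in the exposed face, the segment
to a relative interior point of `F` can be prolonged inside `F`, and extremality puts `z` in `F`. -/
theorem eq_exposedFace_of_subset [FiniteDimensional ℝ E] {C F : Set E} (hC : IsConvexBody C)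
    (hF : F ∈ polytopeFacets C) {u : E} (hu : u ≠ 0) (hFu : F ⊆ exposedFace C u) :
    F = exposedFace C u := by
  refine hFu.antisymm fun z hz => ?_
  obtain ⟨x, hx⟩ := hF.1.intrinsicInterior hF.2.1
  have hxF := intrinsicInterior_subset hx
  obtain ⟨x', hx', rfl⟩ := mem_intrinsicInterior.1 hx
  have hdir : (x' : E) - z ∈ (affineSpan ℝ F).direction := by
    rw [direction_affineSpan, vectorSpan_eq_orthogonal_of_mem_polytopeFacets hC hF hu hFu,
      Submodule.mem_orthogonal_singleton_iff_inner_right, inner_sub_right, sub_eq_zero]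
    exact le_antisymm (hz.2 _ (hFu hxF).1) ((hFu hxF).2 z hz.1)
  let g : ℝ → affineSpan ℝ F := fun ε => ⟨ε • ((x' : E) - z) + x',
    AffineSubspace.vadd_mem_of_mem_direction (Submodule.smul_mem _ ε hdir) x'.2⟩
  have hg : Continuous g := by
    refine Continuous.subtype_mk ?_ _
    fun_prop
  have hg0 : g 0 = x' := by ext; simp [g]
  have hev : ∀ᶠ ε : ℝ in nhds 0, g ε ∈ ((↑) ⁻¹' F : Set (affineSpan ℝ F)) :=
    hg.continuousAt.eventually_mem (by rw [hg0]; exact mem_interior_iff_mem_nhds.1 hx')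
  obtain ⟨ε, h1, h2⟩ := ((hev.filter_mono nhdsWithin_le_nhds).and
    (self_mem_nhdsWithin (s := Set.Ioi (0 : ℝ)))).exists
  have h3 : (x' : E) + ε • ((x' : E) - z) ∈ F := by rw [add_comm]; exact h1
  exact hF.2.2.1.2 hz.1 (hF.2.2.1.1 h3) hxF (mem_openSegment_add_smul_sub _ z h2)

theorem exposedFace_smul {C : Set E} (u : E) {c : ℝ} (hc : 0 < c) :
    exposedFace C (c • u) = exposedFace C u := by
  ext x
  simp only [exposedFace, Set.mem_ofPred_eq, inner_smul_left, conj_trivial, mul_le_mul_iff_right₀ hc]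

/-- The normals of a facet are unique up to scaling. -/
theorem exposedFace_eq_or_eq_of_facet [FiniteDimensional ℝ E] {C F : Set E} (hC : IsConvexBody C)
    (hF : F ∈ polytopeFacets C) {u v : E} (hu : u ≠ 0) (hv : v ≠ 0)
    (hFu : F = exposedFace C u ∨ F = exposedFace C (-u))
    (hFv : F = exposedFace C v ∨ F = exposedFace C (-v)) :
    (exposedFace C v = exposedFace C u ∧ exposedFace C (-v) = exposedFace C (-u)) ∨
      (exposedFace C v = exposedFace C (-u) ∧ exposedFace C (-v) = exposedFace C u) := by
  have key : ∀ w : E, w ≠ 0 → (F = exposedFace C w ∨ F = exposedFace C (-w)) →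
      vectorSpan ℝ F = (Submodule.span ℝ {w})ᗮ := by
    rintro w hw (h | h)
    · exact vectorSpan_eq_orthogonal_of_mem_polytopeFacets hC hF hw h.subset
    · rw [vectorSpan_eq_orthogonal_of_mem_polytopeFacets hC hF (neg_ne_zero.2 hw) h.subset,
        ← Set.neg_singleton, Submodule.span_neg]
  have h := (key v hv hFv).symm.trans (key u hu hFu)
  have hspan : Submodule.span ℝ {v} = Submodule.span ℝ {u} := by
    rw [← Submodule.orthogonal_orthogonal (Submodule.span ℝ {v}), h,
      Submodule.orthogonal_orthogonal]
  obtain ⟨c, rfl⟩ := Submodule.mem_span_singleton.1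
    (hspan ▸ Submodule.mem_span_singleton_self v : v ∈ Submodule.span ℝ {u})
  have hc : c ≠ 0 := by rintro rfl; exact hv (zero_smul _ _)
  rcases hc.lt_or_gt with hc | hc
  · right
    have e1 : c • u = (-c) • (-u) := by simp
    have e2 : -(c • u) = (-c) • u := by simp
    rw [e2, exposedFace_smul _ (neg_pos.2 hc), e1, exposedFace_smul _ (neg_pos.2 hc)]
    exact ⟨rfl, rfl⟩
  · left
    rw [← smul_neg, exposedFace_smul _ hc, exposedFace_smul _ hc]
    exact ⟨rfl, rfl⟩

end Polyhedra

/-! ### Complete bodies: the facet bound -/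

section Diameter

variable {E : Type*} [NormedAddCommGroup E] [InnerProductSpace ℝ E]

theorem norm_sub_div_norm_eq {a b v : E} {t : ℝ} (hv : v ≠ 0) (ht : 0 < t) (h : b - a = t • v) :
    ‖b - a‖ / ‖v‖ = t := by
  rw [h, norm_smul, Real.norm_of_nonneg ht.le, mul_div_cancel_right₀ _ (norm_ne_zero_iff.2 hv)]

theorem latticeDiameter_le {Λ : Submodule ℤ E} {K : Set E} {M : ℝ} (hM : 0 ≤ M)
    (h : ∀ a ∈ K, ∀ b ∈ K, ∀ v, IsPrimitiveVector Λ v → ∀ t : ℝ, 0 < t → b - a = t • v → t ≤ M) :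
    latticeDiameter Λ K ≤ M := by
  refine Real.sSup_le ?_ hM
  rintro _ ⟨a, b, v, hab, ⟨hv, t, ht, he⟩, rfl⟩
  rw [norm_sub_div_norm_eq hv.2.1 ht he]
  exact h a (hab (left_mem_segment ℝ a b)) b (hab (right_mem_segment ℝ a b)) v hv t ht he

variable [FiniteDimensional ℝ E]

theorem exists_pos_le_norm (Λ : Submodule ℤ E) [DiscreteTopology Λ] :
    ∃ δ : ℝ, 0 < δ ∧ ∀ v ∈ Λ, v ≠ 0 → δ ≤ ‖v‖ := by
  let S : Set E := {v | v ∈ Λ ∧ ‖v‖ ≤ 1} \ {0}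
  have hS : S.Finite := (finite_discrete_inter_norm_le Λ 1).sdiff
  by_cases hne : S.Nonempty
  · obtain ⟨w, hw, hmin⟩ := S.exists_min_image (fun v => ‖v‖) hS hne
    refine ⟨‖w‖, norm_pos_iff.2 hw.2, fun v hv hv0 => ?_⟩
    by_cases h : ‖v‖ ≤ 1
    · exact hmin v ⟨⟨hv, h⟩, hv0⟩
    · exact hw.1.2.trans (not_le.1 h).le
  · refine ⟨1, one_pos, fun v hv hv0 => ?_⟩
    by_contra h
    exact hne ⟨v, ⟨hv, (not_le.1 h).le⟩, hv0⟩

/-- The shortest lattice vector on the ray through `v` is primitive. -/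
theorem exists_isPrimitiveVector {Λ : Submodule ℤ E} [DiscreteTopology Λ] {v : E} (hv : v ∈ Λ)
    (hv0 : v ≠ 0) : ∃ w, IsPrimitiveVector Λ w ∧ ∃ m : ℝ, 1 ≤ m ∧ v = m • w := by
  let S : Set E := {x | (x ∈ Λ ∧ ‖x‖ ≤ ‖v‖) ∧ ∃ s : ℝ, 0 < s ∧ x = s • v}
  have hS : S.Finite := (finite_discrete_inter_norm_le Λ ‖v‖).subset fun x hx => hx.1
  obtain ⟨w, ⟨⟨hw, hwv⟩, s, hs, rfl⟩, hmin⟩ :=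
    S.exists_min_image (fun x => ‖x‖) hS ⟨v, ⟨hv, le_rfl⟩, 1, one_pos, by simp⟩
  have hvn : 0 < ‖v‖ := norm_pos_iff.2 hv0
  refine ⟨s • v, ⟨hw, smul_ne_zero hs.ne' hv0, fun t ht ht1 hmem => ?_⟩, 1 / s, ?_, ?_⟩
  · have hn : 0 < ‖s • v‖ := norm_pos_iff.2 (smul_ne_zero hs.ne' hv0)
    have hlt : ‖t • s • v‖ < ‖s • v‖ := by
      rw [norm_smul, Real.norm_of_nonneg ht.le]
      nlinarith
    exact (hmin (t • s • v) ⟨⟨hmem, hlt.le.trans hwv⟩, t * s, mul_pos ht hs, smul_smul _ _ _⟩).not_gt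
      hlt
  · rw [norm_smul, Real.norm_of_nonneg hs.le] at hwv
    rw [le_div_iff₀ hs, one_mul]
    exact le_of_mul_le_mul_right (by simpa using hwv) hvn
  · rw [smul_smul, one_div, inv_mul_cancel₀ hs.ne', one_smul]

theorem bddAbove_latticeDiameter {Λ : Submodule ℤ E} [DiscreteTopology Λ] {K : Set E}
    (hK : IsCompact K) : BddAbove {r : ℝ | ∃ a b v : E, segment ℝ a b ⊆ K ∧
      IsPrimitiveDirection Λ a b v ∧ r = ‖b - a‖ / ‖v‖} := by
  obtain ⟨δ, hδ, hmin⟩ := exists_pos_le_norm Λ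
  refine ⟨Metric.diam K / δ, ?_⟩
  rintro _ ⟨a, b, v, hab, ⟨hv, -⟩, rfl⟩
  have h1 : ‖b - a‖ ≤ Metric.diam K := by
    rw [← dist_eq_norm]
    exact Metric.dist_le_diam_of_mem hK.isBounded (hab (right_mem_segment ℝ a b))
      (hab (left_mem_segment ℝ a b))
  have h2 := hmin v hv.1 hv.2.1
  gcongr

/-- `v` need not be primitive: measured by the primitive vector on its ray, the segment only gets
longer. This lets half-sums of diameter directions be used directly. -/
theorem le_latticeDiameter {Λ : Submodule ℤ E} [DiscreteTopology Λ] {K : Set E}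
    (hK : IsCompact K) (hconv : Convex ℝ K) {a b v : E} {t : ℝ} (ha : a ∈ K) (hb : b ∈ K)
    (hv : v ∈ Λ) (hv0 : v ≠ 0) (ht : 0 < t) (h : b - a = t • v) : t ≤ latticeDiameter Λ K := by
  obtain ⟨w, hw, m, hm, rfl⟩ := exists_isPrimitiveVector hv hv0
  have hm0 : 0 < m := one_pos.trans_le hm
  rw [smul_smul] at h
  refine le_trans ?_ (le_csSup (bddAbove_latticeDiameter hK) ⟨a, b, w, hconv.segment_subset ha hb,
    ⟨hw, t * m, mul_pos ht hm0, h⟩, rfl⟩)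
  rw [norm_sub_div_norm_eq hw.2.1 (mul_pos ht hm0) h]
  nlinarith

theorem latticeDiameter_nonneg (Λ : Submodule ℤ E) (K : Set E) : 0 ≤ latticeDiameter Λ K := by
  refine Real.sSup_nonneg ?_
  rintro _ ⟨a, b, v, -, -, rfl⟩
  positivity

theorem latticeDiameter_pos {Λ : Submodule ℤ E} [DiscreteTopology Λ] {C : Set E}
    (hC : IsConvexBody C) {v : E} (hv : v ∈ Λ) (hv0 : v ≠ 0) : 0 < latticeDiameter Λ C := by
  obtain ⟨c, r, hr, hball⟩ := hC.exists_closedBall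
  have hn := norm_pos_iff.2 hv0
  have ht : 0 < r / ‖v‖ := div_pos hr hn
  refine ht.trans_le (le_latticeDiameter hC.2.1 hC.1 (a := c) (b := c + (r / ‖v‖) • v)
    (hball (Metric.mem_closedBall_self hr.le)) (hball ?_) hv hv0 ht (add_sub_cancel_left _ _))
  rw [mem_closedBall_iff_norm, add_sub_cancel_left, norm_smul, norm_div, norm_norm,
    div_mul_cancel₀ _ hn.ne', Real.norm_of_nonneg hr.le]

theorem exists_sub_eq_of_mem_diameterDirections {Λ : Submodule ℤ E} {C : Set E} {v : E}
    (hv : v ∈ diameterDirections Λ C) :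
    ∃ a ∈ C, ∃ b ∈ C, b - a = latticeDiameter Λ C • v := by
  obtain ⟨a, b, hab, ⟨hv, t, ht, he⟩, hd⟩ := hv
  rw [norm_sub_div_norm_eq hv.2.1 ht he] at hd
  exact ⟨a, hab (left_mem_segment ℝ a b), b, hab (right_mem_segment ℝ a b), hd ▸ he⟩

theorem isPrimitiveVector_of_mem_diameterDirections {Λ : Submodule ℤ E} {C : Set E} {v : E}
    (hv : v ∈ diameterDirections Λ C) : IsPrimitiveVector Λ v := by
  obtain ⟨a, b, -, h, -⟩ := hv
  exact h.1

theorem diameterDirections_finite {Λ : Submodule ℤ E} [DiscreteTopology Λ] {C : Set E}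
    (hC : IsConvexBody C) : (diameterDirections Λ C).Finite := by
  refine (finite_discrete_inter_norm_le Λ (Metric.diam C / latticeDiameter Λ C)).subset ?_
  intro v hv
  have hp := isPrimitiveVector_of_mem_diameterDirections hv
  obtain ⟨a, ha, b, hb, he⟩ := exists_sub_eq_of_mem_diameterDirections hv
  have hpos := latticeDiameter_pos hC hp.1 hp.2.1
  refine ⟨hp.1, ?_⟩
  rw [le_div_iff₀ hpos, mul_comm, ← Real.norm_of_nonneg hpos.le, ← norm_smul,
    ← he, ← dist_eq_norm]
  exact Metric.dist_le_diam_of_mem hC.2.1.isBounded hb ha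

/-- `u` is a normal of a hyperplane pair supporting `C` at the ends of a segment in direction
`v` of lattice length the lattice diameter. -/
def IsDiametralNormal (Λ : Submodule ℤ E) (C : Set E) (v u : E) : Prop :=
  u ≠ 0 ∧ ∀ x ∈ C, ∀ y ∈ C, ⟪u, x - y⟫ ≤ latticeDiameter Λ C * ⟪u, v⟫

open scoped Pointwise in
-- With `l` the lattice diameter, `l • z` is not interior to the difference body `C - C`, since `C`
-- would then contain a longer segment along `z`. A hyperplane separating it from that interior
-- supplies `u`. No segment along `z` has to attain the diameter.
theorem exists_isDiametralNormal {Λ : Submodule ℤ E} [DiscreteTopology Λ] {C : Set E}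
    (hC : IsConvexBody C) {z : E} (hz : z ∈ Λ) (hz0 : z ≠ 0) :
    ∃ u, IsDiametralNormal Λ C z u := by
  set l := latticeDiameter Λ C with hl
  have hlpos : 0 < l := latticeDiameter_pos hC hz hz0
  have hconv : Convex ℝ (C - C) := hC.1.sub hC.1
  have hsub : ∀ x ∈ interior C, ∀ y ∈ C, x - y ∈ interior (C - C) := by
    intro x hx y hy
    refine interior_mono (s := interior C - {y}) ?_ ?_
    · exact Set.sub_subset_sub interior_subset (Set.singleton_subset_iff.2 hy)
    · rw [isOpen_interior.sub_right.interior_eq]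
      exact Set.sub_mem_sub hx rfl
  have hne : (interior (C - C)).Nonempty := by
    obtain ⟨c, hc⟩ := hC.2.2
    exact ⟨_, hsub c hc c (interior_subset hc)⟩
  have hnot : l • z ∉ interior (C - C) := by
    intro hi
    have hcont : Continuous fun ε : ℝ => (l + ε) • z := by fun_prop
    have hev : ∀ᶠ ε : ℝ in nhds 0, (l + ε) • z ∈ C - C :=
      hcont.continuousAt.eventually_mem (by simpa using mem_interior_iff_mem_nhds.1 hi)
    obtain ⟨ε, h1, h2⟩ := ((hev.filter_mono nhdsWithin_le_nhds).and
      (self_mem_nhdsWithin (s := Set.Ioi (0 : ℝ)))).exists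
    obtain ⟨b, hb, a, ha, he⟩ := h1
    have h2' : 0 < ε := h2
    have := le_latticeDiameter hC.2.1 hC.1 ha hb hz hz0 (by positivity) he
    linarith
  obtain ⟨f, hf⟩ := geometric_hahn_banach_open_point hconv.interior isOpen_interior hnot
  obtain ⟨c, hc⟩ := hC.2.2
  have hu : ∀ x, ⟪(InnerProductSpace.toDual ℝ E).symm f, x⟫ = f x :=
    fun x => InnerProductSpace.toDual_symm_apply
  refine ⟨(InnerProductSpace.toDual ℝ E).symm f, ?_, ?_⟩
  · intro h0
    have h1 := hf _ hne.some_mem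
    rw [← hu, ← hu, h0, inner_zero_left, inner_zero_left] at h1
    exact lt_irrefl _ h1
  · intro x hx y hy
    rw [hu, hu, ← hl, ← smul_eq_mul, ← map_smul]
    have hcl : x - y ∈ closure (interior (C - C)) := by
      rw [hconv.closure_interior_eq_closure_of_nonempty_interior hne]
      exact subset_closure (Set.sub_mem_sub hx hy)
    have := map_mem_closure f.continuous hcl (t := Set.Iic (f (l • z))) fun w hw => (hf w hw).le
    rwa [isClosed_Iic.closure_eq] at this

theorem IsDiametralNormal.inner_pos {Λ : Submodule ℤ E} [DiscreteTopology Λ] {C : Set E}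
    (hC : IsConvexBody C) {v u : E} (hv : v ∈ Λ) (hv0 : v ≠ 0)
    (hu : IsDiametralNormal Λ C v u) : 0 < ⟪u, v⟫ := by
  have hlpos := latticeDiameter_pos hC hv hv0
  obtain ⟨c, r, hr, hball⟩ := hC.exists_closedBall
  have h1 := mul_norm_le_directionalWidth hC.2.1 hr.le hball u
  have h2 := directionalWidth_le hC.nonempty hu.2
  have h3 := mul_pos hr (norm_pos_iff.2 hu.1)
  exact pos_of_mul_pos_right (h3.trans_le (h1.trans h2)) hlpos.le

theorem IsDiametralNormal.mem_exposedFace {Λ : Submodule ℤ E} {C : Set E} {v u a b : E}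
    (hu : IsDiametralNormal Λ C v u) (ha : a ∈ C) (hb : b ∈ C)
    (h : b - a = latticeDiameter Λ C • v) :
    b ∈ exposedFace C u ∧ a ∈ exposedFace C (-u) := by
  have h1 : ⟪u, b⟫ - ⟪u, a⟫ = latticeDiameter Λ C * ⟪u, v⟫ := by
    rw [← inner_sub_right, h, inner_smul_right]
  refine ⟨⟨hb, fun x hx => ?_⟩, ha, fun x hx => ?_⟩
  · have := hu.2 x hx a ha
    rw [inner_sub_right] at this
    linarith
  · have := hu.2 b hb x hx
    rw [inner_sub_right] at this
    simp only [inner_neg_left]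
    linarith

theorem IsDiametralNormal.neg {Λ : Submodule ℤ E} {C : Set E} {v u : E}
    (hu : IsDiametralNormal Λ C v u) : IsDiametralNormal Λ C (-v) (-u) := by
  refine ⟨neg_ne_zero.2 hu.1, fun x hx y hy => ?_⟩
  rw [inner_neg_neg, inner_neg_left, ← inner_neg_right, neg_sub]
  exact hu.2 y hy x hx

/-- Diameter directions whose half-sum is a non-zero lattice vector have a common normal. -/
theorem exists_common_isDiametralNormal {Λ : Submodule ℤ E} [DiscreteTopology Λ] {C : Set E}
    (hC : IsConvexBody C) {s t z : E} (hs : s ∈ diameterDirections Λ C)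
    (ht : t ∈ diameterDirections Λ C) (hz : z ∈ Λ) (hz0 : z ≠ 0) (h : s + t = (2 : ℤ) • z) :
    ∃ u, IsDiametralNormal Λ C s u ∧ IsDiametralNormal Λ C t u := by
  obtain ⟨u, hu0, hu⟩ := exists_isDiametralNormal hC hz hz0
  obtain ⟨a, ha, b, hb, hab⟩ := exists_sub_eq_of_mem_diameterDirections hs
  obtain ⟨a', ha', b', hb', hab'⟩ := exists_sub_eq_of_mem_diameterDirections ht
  -- The diameter segments along `s` and `t` give `⟪u, s⟫ ≤ ⟪u, z⟫` and `⟪u, t⟫ ≤ ⟪u, z⟫` up to the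
  -- factor `latticeDiameter Λ C`. These sum to an equality, so a normal for `z` is one for `s` and
  -- `t`.
  have h1 := hu b hb a ha
  have h2 := hu b' hb' a' ha'
  rw [hab, inner_smul_right] at h1
  rw [hab', inner_smul_right] at h2
  have h3 : ⟪u, s⟫ + ⟪u, t⟫ = 2 * ⟪u, z⟫ := by
    rw [← inner_add_right, h, two_smul, inner_add_right]; ring
  have h4 : latticeDiameter Λ C * ⟪u, s⟫ + latticeDiameter Λ C * ⟪u, t⟫ =
      2 * (latticeDiameter Λ C * ⟪u, z⟫) := by rw [← mul_add, h3]; ring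
  refine ⟨u, ⟨hu0, fun x hx y hy => ?_⟩, hu0, fun x hx y hy => ?_⟩ <;>
  · have := hu x hx y hy
    linarith

open scoped Pointwise in
/-- Only the diameter directions prevent a slight enlargement of a convex body from keeping its
lattice diameter. -/
theorem exists_cthickening_le_of_notMem_diameterDirections {Λ : Submodule ℤ E}
    [DiscreteTopology Λ] {C : Set E} (hC : IsConvexBody C) :
    ∃ ε : ℝ, 0 < ε ∧ ∀ v, IsPrimitiveVector Λ v → v ∉ diameterDirections Λ C →
      ∀ x ∈ Metric.cthickening ε C, ∀ y ∈ Metric.cthickening ε C, ∀ t : ℝ, 0 < t →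
        y - x = t • v → t ≤ latticeDiameter Λ C := by
  set l := latticeDiameter Λ C with hl
  -- Only these non-diameter directions can carry a segment longer than `l` in the neighbourhood of
  -- radius at most 1. The rays `R` of their multiples by `t ≥ l` are closed and miss the compact
  -- set `C - C`, hence stay some distance `δ` away.
  let S : Set E := {v | (v ∈ Λ ∧ ‖v‖ ≤ (Metric.diam C + 2) / l) ∧ IsPrimitiveVector Λ v ∧
    v ∉ diameterDirections Λ C}
  have hS : S.Finite := (finite_discrete_inter_norm_le Λ _).subset fun v hv => hv.1
  let R : Set E := ⋃ v ∈ S, (fun t : ℝ => t • v) '' Set.Ici l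
  have hR : IsClosed R := by
    refine hS.isClosed_biUnion fun v hv => ?_
    exact (isClosedEmbedding_smul_left hv.2.1.2.1).isClosedMap _ isClosed_Ici
  have hdisj : Disjoint (C - C) R := by
    rw [Set.disjoint_left]
    rintro _ ⟨b, hb, a, ha, rfl⟩ hmem
    obtain ⟨v, hv, t, ht, he⟩ := Set.mem_iUnion₂.1 hmem
    have hpos : 0 < l := latticeDiameter_pos hC hv.1.1 hv.2.1.2.1
    have ht0 : 0 < t := hpos.trans_le ht
    have hle := le_latticeDiameter hC.2.1 hC.1 ha hb hv.1.1 hv.2.1.2.1 ht0 he.symm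
    refine hv.2.2 ⟨a, b, hC.1.segment_subset ha hb, ⟨hv.2.1, t, ht0, he.symm⟩, ?_⟩
    rw [norm_sub_div_norm_eq hv.2.1.2.1 ht0 he.symm]
    exact le_antisymm hle ht
  have hcomp : IsCompact (C - C) := by
    rw [sub_eq_add_neg]
    exact hC.2.1.add hC.2.1.neg
  obtain ⟨δ, hδ, hδd⟩ := hdisj.exists_cthickenings hcomp hR
  -- A difference of two points moves by at most twice the radius, hence the half; the bound 1
  -- justifies the `+ 2` in `S`.
  have hε : 0 < min (δ / 2) 1 := lt_min (by positivity) one_pos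
  refine ⟨min (δ / 2) 1, hε, ?_⟩
  intro v hv hvD x hx y hy t ht he
  by_contra hlt
  rw [not_le] at hlt
  have hpos : 0 < l := latticeDiameter_pos hC hv.1 hv.2.1
  rw [hC.2.1.cthickening_eq_biUnion_closedBall hε.le] at hx hy
  obtain ⟨x₀, hx₀, hxx⟩ := Set.mem_iUnion₂.1 hx
  obtain ⟨y₀, hy₀, hyy⟩ := Set.mem_iUnion₂.1 hy
  rw [mem_closedBall_iff_norm] at hxx hyy
  have hclose : ‖(y - x) - (y₀ - x₀)‖ ≤ 2 * min (δ / 2) 1 := by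
    have : (y - x) - (y₀ - x₀) = (y - y₀) - (x - x₀) := by abel
    rw [this]
    exact (norm_sub_le _ _).trans (by linarith)
  have h1 : min (δ / 2) 1 ≤ δ / 2 := min_le_left _ _
  have h2 : min (δ / 2) 1 ≤ 1 := min_le_right _ _
  have hdiam : ‖y₀ - x₀‖ ≤ Metric.diam C := by
    rw [← dist_eq_norm]
    exact Metric.dist_le_diam_of_mem hC.2.1.isBounded hy₀ hx₀
  have hvS : v ∈ S := by
    refine ⟨⟨hv.1, ?_⟩, hv, hvD⟩
    rw [le_div_iff₀ hpos]
    have h3 : ‖y - x‖ ≤ Metric.diam C + 2 := by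
      have := norm_le_norm_add_norm_sub' (y - x) (y₀ - x₀)
      linarith
    rw [he, norm_smul, Real.norm_of_nonneg ht.le] at h3
    nlinarith [norm_nonneg v]
  have hmem : y - x ∈ Metric.cthickening δ (C - C) :=
    Metric.mem_cthickening_of_dist_le _ (y₀ - x₀) _ _ (Set.sub_mem_sub hy₀ hx₀)
      (by rw [dist_eq_norm]; linarith)
  exact Set.disjoint_left.1 hδd hmem (Metric.self_subset_cthickening _ (Set.mem_iUnion₂.2 ⟨v, hvS, t, hlt.le, he.symm⟩))

theorem latticeDiameter_mono {Λ : Submodule ℤ E} [DiscreteTopology Λ] {K K' : Set E}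
    (hK' : IsCompact K') (hconv : Convex ℝ K') (h : K ⊆ K') :
    latticeDiameter Λ K ≤ latticeDiameter Λ K' :=
  latticeDiameter_le (latticeDiameter_nonneg Λ K') fun _ ha _ hb _ hv _ ht he =>
    le_latticeDiameter hK' hconv (h ha) (h hb) hv.1 hv.2.1 ht he

/-- Take `h` to be the support function of `C`. Near `C`, the polyhedron has no larger lattice
diameter: the slabs control the diameter directions, closeness to `C` all others. By completeness it
agrees with `C` there, and connectedness makes this global. -/
theorem IsLatticeComplete.eq_polyhedron {Λ : Submodule ℤ E} [DiscreteTopology Λ] {C : Set E}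
    (hC : IsLatticeComplete Λ C) (u : E → E)
    (hu : ∀ v ∈ diameterDirections Λ C, IsDiametralNormal Λ C v (u v)) :
    ∃ h : E → ℝ, C = polyhedron (u '' diameterDirections Λ C ∪
      (fun v => -u v) '' diameterDirections Λ C) h := by
  obtain ⟨hb, hmax⟩ := hC
  choose p hp using exposedFace_nonempty hb.2.1 hb.nonempty
  refine ⟨fun w => ⟪w, p w⟫, ?_⟩
  set U := u '' diameterDirections Λ C ∪ (fun v => -u v) '' diameterDirections Λ C with hU
  set P := polyhedron U fun w => ⟪w, p w⟫ with hP
  have hCP : C ⊆ P := fun x hx w _ => (hp w).2 x hx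
  obtain ⟨ε, hε, hthick⟩ := exists_cthickening_le_of_notMem_diameterDirections (Λ := Λ) hb
  have hsub : C ⊆ P ∩ Metric.cthickening ε C :=
    Set.subset_inter hCP (Metric.self_subset_cthickening C)
  have hcomp : IsCompact (P ∩ Metric.cthickening ε C) :=
    hb.2.1.cthickening.inter_left (isClosed_polyhedron _ _)
  have hconv : Convex ℝ (P ∩ Metric.cthickening ε C) :=
    (convex_polyhedron _ _).inter (hb.1.cthickening ε)
  have hdiam : latticeDiameter Λ (P ∩ Metric.cthickening ε C) = latticeDiameter Λ C := by
    refine le_antisymm (latticeDiameter_le (latticeDiameter_nonneg Λ C) ?_)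
      (latticeDiameter_mono hcomp hconv hsub)
    intro x hx y hy v hv t ht he
    by_cases hvD : v ∈ diameterDirections Λ C
    · obtain ⟨a, ha, b, hb', hab⟩ := exists_sub_eq_of_mem_diameterDirections hvD
      obtain ⟨hbf, haf⟩ := (hu v hvD).mem_exposedFace ha hb' hab
      have h1 : ⟪u v, y⟫ ≤ ⟪u v, b⟫ :=
        (hy.1 (u v) (Or.inl ⟨v, hvD, rfl⟩)).trans (hbf.2 _ (hp _).1)
      have h2 : ⟪-u v, x⟫ ≤ ⟪-u v, a⟫ :=
        (hx.1 (-u v) (Or.inr ⟨v, hvD, rfl⟩)).trans (haf.2 _ (hp _).1)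
      rw [inner_neg_left, inner_neg_left] at h2
      have h3 : t * ⟪u v, v⟫ ≤ latticeDiameter Λ C * ⟪u v, v⟫ := by
        rw [← inner_smul_right, ← inner_smul_right, ← he, ← hab, inner_sub_right, inner_sub_right]
        linarith
      exact le_of_mul_le_mul_right h3 ((hu v hvD).inner_pos hb hv.1 hv.2.1)
    · exact hthick v hv hvD x hx.2 y hy.2 t ht he
  have heq : C = P ∩ Metric.cthickening ε C := by
    by_contra hne
    exact hmax ⟨_, ⟨hconv, hcomp, hb.2.2.mono (interior_mono hsub)⟩, hsub.ssubset_of_ne hne, hdiam⟩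
  have hthickC : P ∩ Metric.thickening ε C ⊆ C := by
    intro x hx
    rw [heq]
    exact ⟨hx.1, Metric.thickening_subset_cthickening ε C hx.2⟩
  refine hCP.antisymm ?_
  -- `C` is closed, and open relative to the connected set `P`, so it is all of `P`.
  have hpre := (convex_polyhedron U fun w => ⟪w, p w⟫).isPreconnected
  rcases isPreconnected_iff_subset_of_disjoint.1 hpre (Metric.thickening ε C) Cᶜ
    Metric.isOpen_thickening hb.2.1.isClosed.isOpen_compl (fun x _ => by
      by_cases hx : x ∈ C
      · exact Or.inl (Metric.self_subset_thickening hε C hx)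
      · exact Or.inr hx) (by
      ext x
      simp only [Set.mem_inter_iff, Set.mem_empty_iff_false, iff_false]
      rintro ⟨h1, h2, h3⟩
      exact h3 (hthickC ⟨h1, h2⟩)) with h | h
  · exact fun x hx => hthickC ⟨hx, h hx⟩
  · obtain ⟨x, hx⟩ := hb.nonempty
    exact (h (hCP hx) hx).elim

theorem IsLatticeComplete.isPolytope {Λ : Submodule ℤ E} [DiscreteTopology Λ] {C : Set E}
    (hC : IsLatticeComplete Λ C) : IsPolytope C := by
  have h : ∀ v ∈ diameterDirections Λ C, ∃ u, IsDiametralNormal Λ C v u := fun v hv =>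
    have hp := isPrimitiveVector_of_mem_diameterDirections hv
    exists_isDiametralNormal hC.1 hp.1 hp.2.1
  choose! u hu using h
  obtain ⟨h, hCh⟩ := hC.eq_polyhedron u hu
  have hfin := diameterDirections_finite (Λ := Λ) hC.1
  exact isPolytope_of_eq_polyhedron ((hfin.image _).union (hfin.image _)) hC.1.2.1 hCh

/-- Otherwise each diameter direction has a normal that does not expose `F`; these normals still cut
out `C`, so one of them or its negative does expose `F`. The quantifier over all `u` is needed
because the common normal of two congruent directions cannot be prescribed. -/
theorem IsLatticeComplete.exists_forall_eq_exposedFace {Λ : Submodule ℤ E} [DiscreteTopology Λ]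
    {C F : Set E} (hC : IsLatticeComplete Λ C) (hF : F ∈ polytopeFacets C) :
    ∃ v ∈ diameterDirections Λ C, ∀ u, IsDiametralNormal Λ C v u →
      F = exposedFace C u ∨ F = exposedFace C (-u) := by
  by_contra! hcon
  choose! u hu hne1 hne2 using hcon
  obtain ⟨h, hCh⟩ := hC.eq_polyhedron u hu
  have hfin := diameterDirections_finite (Λ := Λ) hC.1
  obtain ⟨w, hw, hFw⟩ := exists_subset_exposedFace_of_mem_polytopeFacets
    ((hfin.image u).union (hfin.image fun v => -u v)) hCh hF
  rcases hw with ⟨v, hv, rfl⟩ | ⟨v, hv, rfl⟩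
  · exact hne1 v hv (eq_exposedFace_of_subset hC.1 hF (hu v hv).1 hFw)
  · exact hne2 v hv (eq_exposedFace_of_subset hC.1 hF (neg_ne_zero.2 (hu v hv).1) hFw)

theorem IsLatticeComplete.encard_facets_le {Λ : Submodule ℤ E} [DiscreteTopology Λ] {C : Set E}
    (hC : IsLatticeComplete Λ C) :
    (polytopeFacets C).encard ≤ ((2 ^ (Module.finrank ℝ
      (Submodule.span ℝ (diameterDirections Λ C)) + 1) - 2 : ℕ) : ℕ∞) := by
  have h := fun F (hF : F ∈ polytopeFacets C) => hC.exists_forall_eq_exposedFace hF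
  choose! v hv hvF using h
  have hprim := fun F (hF : F ∈ polytopeFacets C) =>
    isPrimitiveVector_of_mem_diameterDirections (hv F hF)
  have hpair : ∀ F ∈ polytopeFacets C, ∀ G ∈ polytopeFacets C,
      (∃ a ∈ Λ, v F - v G = (2 : ℤ) • a) →
      ∀ u, IsDiametralNormal Λ C (v F) u → G = exposedFace C u ∨ G = exposedFace C (-u) := by
    rintro F hF G hG ⟨a, ha, hFG⟩ u hu
    have hFu := hvF F hF u hu
    -- Some `w` serves both facets: `u` itself if the directions are opposite, a common normal
    -- otherwise. As `F` has only one normal line, `w` can be replaced by `u`.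
    obtain ⟨w, hw0, hwF, hwG⟩ : ∃ w, w ≠ 0 ∧ (F = exposedFace C w ∨ F = exposedFace C (-w)) ∧
        (G = exposedFace C w ∨ G = exposedFace C (-w)) := by
      by_cases hz : a + v G = 0
      · have h1 : a = - v G := eq_neg_of_add_eq_zero_left hz
        have h2 : v G = - v F := by
          rw [h1, sub_eq_iff_eq_add, two_smul] at hFG
          rw [hFG]; abel
        have h3 := hvF G hG (-u) (h2 ▸ hu.neg)
        rw [neg_neg] at h3
        exact ⟨u, hu.1, hFu, h3.symm⟩
      · obtain ⟨w, hw1, hw2⟩ := exists_common_isDiametralNormal hC.1 (hv F hF) (hv G hG)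
          (add_mem ha (hprim G hG).1) hz (by
            rw [sub_eq_iff_eq_add] at hFG
            rw [hFG, smul_add, two_smul ℤ (v G)]; abel)
        exact ⟨w, hw1.1, hvF F hF w hw1, hvF G hG w hw2⟩
    rcases exposedFace_eq_or_eq_of_facet hC.1 hF hu.1 hw0 hFu hwF with ⟨e1, e2⟩ | ⟨e1, e2⟩
    · rwa [e1, e2] at hwG
    · rw [e1, e2] at hwG
      exact hwG.symm
  refine encard_le_of_parity Λ (polytopeFacets C) v (diameterDirections Λ C)
    (fun F hF => (hprim F hF).1) hv ?_ ?_
  · intro F hF z hz h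
    refine (hprim F hF).2.2 (1 / 2) (by norm_num) (by norm_num) ?_
    rw [h, two_smul, smul_add, ← add_smul]
    norm_num
    exact hz
  · intro F hF G hG H hH h1 h2
    -- All three facets are among the two faces exposed by `u` and `-u`.
    obtain ⟨u, hu⟩ := exists_isDiametralNormal hC.1 (hprim F hF).1 (hprim F hF).2.1
    have eF := hvF F hF u hu
    have eG := hpair F hF G hG h1 u hu
    have eH := hpair F hF H hH h2 u hu
    rcases eF with eF | eF <;> rcases eG with eG | eG <;> rcases eH with eH | eH <;>
      simp [eF, eG, eH]

end Diameter

/-! ### Voronoi cells are complete, their polars reduced -/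

section Voronoi

variable {E : Type*} [NormedAddCommGroup E] [InnerProductSpace ℝ E]

/-- The vectors `w i` are the Voronoi relevant vectors of `L`: they are lattice vectors that cut
out the Voronoi cell, each of them irredundantly. -/
structure IsVoronoiRelevant {ι : Type*} (L : Submodule ℤ E) (w : ι → E) : Prop where
  mem : ∀ i, w i ∈ L
  ne_zero : ∀ i, w i ≠ 0
  inner_lt : ∀ i j, i ≠ j → ⟪w i, w j⟫ < ‖w j‖ ^ 2
  exists_neg : ∀ i, ∃ j, w j = - w i
  cell : ∀ x, (∀ i, ⟪w i, x⟫ ≤ ‖w i‖ ^ 2 / 2) → ∀ a ∈ L, ⟪a, x⟫ ≤ ‖a‖ ^ 2 / 2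
  bounded : Bornology.IsBounded (voronoiCell L)
  nonempty : Nonempty ι

theorem mem_voronoiCell_iff {L : Submodule ℤ E} {x : E} :
    x ∈ voronoiCell L ↔ ∀ a ∈ L, ⟪a, x⟫ ≤ ‖a‖ ^ 2 / 2 := by
  refine forall₂_congr fun a _ => ?_
  rw [← abs_of_nonneg (norm_nonneg x), ← abs_of_nonneg (norm_nonneg (x - a)), ← sq_le_sq,
    norm_sub_sq_real, real_inner_comm]
  constructor <;> intro h <;> linarith

namespace IsVoronoiRelevant

variable {ι : Type*} {L : Submodule ℤ E} {w : ι → E}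

theorem voronoiCell_eq (hw : IsVoronoiRelevant L w) :
    voronoiCell L = polyhedron (Set.range w) fun u => ‖u‖ ^ 2 / 2 := by
  ext x
  rw [mem_voronoiCell_iff]
  constructor
  · rintro h _ ⟨i, rfl⟩
    exact h _ (hw.mem i)
  · exact fun h => hw.cell x fun i => h _ ⟨i, rfl⟩

theorem norm_sq_pos (hw : IsVoronoiRelevant L w) (i : ι) : 0 < ‖w i‖ ^ 2 :=
  pow_pos (norm_pos_iff.2 (hw.ne_zero i)) 2

theorem half_mem (hw : IsVoronoiRelevant L w) (i : ι) : (1 / 2 : ℝ) • w i ∈ voronoiCell L := by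
  rw [hw.voronoiCell_eq]
  rintro _ ⟨j, rfl⟩
  rw [inner_smul_right, real_inner_comm]
  by_cases h : i = j
  · rw [h, real_inner_self_eq_norm_sq]; linarith
  · linarith [hw.inner_lt i j h]

theorem eq_of_inner_half_eq (hw : IsVoronoiRelevant L w) {i j : ι}
    (h : ⟪w j, (1 / 2 : ℝ) • w i⟫ = ‖w j‖ ^ 2 / 2) : i = j := by
  by_contra hij
  rw [inner_smul_right, real_inner_comm] at h
  linarith [hw.inner_lt i j hij]

theorem half_mem_exposedFace (hw : IsVoronoiRelevant L w) (i : ι) :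
    (1 / 2 : ℝ) • w i ∈ exposedFace (voronoiCell L) (w i) := by
  refine ⟨hw.half_mem i, fun y hy => ?_⟩
  rw [inner_smul_right, real_inner_self_eq_norm_sq]
  linarith [mem_voronoiCell_iff.1 hy (w i) (hw.mem i)]

variable [Finite ι]

/-- At the facet centre `w i / 2` only the `i`-th constraint is tight, by irredundancy. -/
theorem exists_half_add_mem (hw : IsVoronoiRelevant L w) (i : ι) {v : E} (hv : ⟪w i, v⟫ ≤ 0) :
    ∃ ε : ℝ, 0 < ε ∧ (1 / 2 : ℝ) • w i + ε • v ∈ voronoiCell L := by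
  have h := hw.half_mem i
  rw [hw.voronoiCell_eq] at h ⊢
  refine exists_pos_forall_add_smul_mem_polyhedron (Set.finite_range w) h ?_
  rintro _ ⟨j, rfl⟩ he
  rwa [← hw.eq_of_inner_half_eq he]

variable [FiniteDimensional ℝ E]

theorem isConvexBody (hw : IsVoronoiRelevant L w) : IsConvexBody (voronoiCell L) := by
  have hb := hw.bounded
  rw [hw.voronoiCell_eq] at hb ⊢
  refine ⟨convex_polyhedron _ _, Metric.isCompact_of_isClosed_isBounded (isClosed_polyhedron _ _) hb,
    0, mem_interior_polyhedron (Set.finite_range w) ?_⟩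
  rintro _ ⟨i, rfl⟩
  rw [inner_zero_right]
  linarith [hw.norm_sq_pos i]

theorem exposedFace_mem_polytopeFacets (hw : IsVoronoiRelevant L w) (i : ι) :
    exposedFace (voronoiCell L) (w i) ∈ polytopeFacets (voronoiCell L) := by
  have hspan : vectorSpan ℝ (exposedFace (voronoiCell L) (w i)) = (Submodule.span ℝ {w i})ᗮ := by
    refine le_antisymm (vectorSpan_exposedFace_le _) fun v hv => ?_
    rw [Submodule.mem_orthogonal_singleton_iff_inner_right] at hv
    obtain ⟨ε, hε, hmem⟩ := hw.exists_half_add_mem i hv.le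
    have hface : (1 / 2 : ℝ) • w i + ε • v ∈ exposedFace (voronoiCell L) (w i) := by
      refine ⟨hmem, fun y hy => ?_⟩
      rw [inner_add_right, inner_smul_right _ v, hv, mul_zero, add_zero]
      exact (hw.half_mem_exposedFace i).2 y hy
    have h := vsub_mem_vectorSpan ℝ hface (hw.half_mem_exposedFace i)
    rw [vsub_eq_sub, add_sub_cancel_left] at h
    simpa [smul_smul, inv_mul_cancel₀ hε.ne'] using Submodule.smul_mem _ ε⁻¹ h
  refine ⟨⟨_, hw.half_mem_exposedFace i⟩, convex_exposedFace hw.isConvexBody.1 _,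
    isExtreme_exposedFace _ _, ?_⟩
  rw [hspan, vectorSpan_eq_top_of_interior_nonempty hw.isConvexBody.2.2, finrank_top,
    finrank_orthogonal_singleton_add_one (hw.ne_zero i)]

theorem polytopeFacets_eq_range (hw : IsVoronoiRelevant L w) :
    polytopeFacets (voronoiCell L) = Set.range fun i => exposedFace (voronoiCell L) (w i) := by
  ext F
  constructor
  · intro hF
    obtain ⟨_, ⟨i, rfl⟩, hFi⟩ :=
      exists_subset_exposedFace_of_mem_polytopeFacets (Set.finite_range w) hw.voronoiCell_eq hF
    exact ⟨i, (eq_exposedFace_of_subset hw.isConvexBody hF (hw.ne_zero i) hFi).symm⟩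
  · rintro ⟨i, rfl⟩
    exact hw.exposedFace_mem_polytopeFacets i

theorem encard_polytopeFacets (hw : IsVoronoiRelevant L w) :
    (polytopeFacets (voronoiCell L)).encard = Nat.card ι := by
  have hinj : Function.Injective fun i => exposedFace (voronoiCell L) (w i) := by
    intro i j hij
    have h1 : (1 / 2 : ℝ) • w i ∈ exposedFace (voronoiCell L) (w j) := by
      have := hw.half_mem_exposedFace i
      simp only at hij
      rwa [hij] at this
    have h2 := h1.2 _ (hw.half_mem j)
    have h3 := (hw.half_mem_exposedFace j).2 _ h1.1
    refine hw.eq_of_inner_half_eq ((le_antisymm h3 h2).trans ?_)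
    rw [inner_smul_right, real_inner_self_eq_norm_sq]
    ring
  rw [hw.polytopeFacets_eq_range, ← Set.image_univ, hinj.encard_image, Set.encard_univ,
    ENat.card_eq_coe_natCard]

theorem neg_half_mem (hw : IsVoronoiRelevant L w) (i : ι) :
    -((1 / 2 : ℝ) • w i) ∈ voronoiCell L := by
  obtain ⟨j, hj⟩ := hw.exists_neg i
  rw [← smul_neg, ← hj]
  exact hw.half_mem j

/-- The constraints of `v` and `-v` bound a slab that allows length 1 along `v`; the segment from
`-w i / 2` to `w i / 2` attains it. -/
theorem latticeDiameter_eq_one [DiscreteTopology L] (hw : IsVoronoiRelevant L w) :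
    latticeDiameter L (voronoiCell L) = 1 := by
  apply le_antisymm
  · refine latticeDiameter_le zero_le_one fun a ha b hb v hv t ht he => ?_
    have h1 := mem_voronoiCell_iff.1 hb v hv.1
    have h2 := mem_voronoiCell_iff.1 ha (-v) (neg_mem hv.1)
    rw [inner_neg_left, norm_neg] at h2
    have h3 : ⟪v, b⟫ - ⟪v, a⟫ = t * ‖v‖ ^ 2 := by
      rw [← inner_sub_right, he, inner_smul_right, real_inner_self_eq_norm_sq]
    have h4 : 0 < ‖v‖ ^ 2 := pow_pos (norm_pos_iff.2 hv.2.1) 2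
    by_contra hlt
    nlinarith
  · obtain ⟨i⟩ := hw.nonempty
    refine le_latticeDiameter hw.isConvexBody.2.1 hw.isConvexBody.1 (hw.neg_half_mem i)
      (hw.half_mem i) (hw.mem i) (hw.ne_zero i) one_pos ?_
    module

theorem isLatticeComplete [DiscreteTopology L] (hw : IsVoronoiRelevant L w) :
    IsLatticeComplete L (voronoiCell L) := by
  refine ⟨hw.isConvexBody, ?_⟩
  rintro ⟨C', hC', hsub, hd⟩
  rw [hw.latticeDiameter_eq_one] at hd
  obtain ⟨x, hx, hxV⟩ := Set.exists_of_ssubset hsub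
  have hi : ∃ i, ‖w i‖ ^ 2 / 2 < ⟪w i, x⟫ := by
    by_contra! hcon
    exact hxV (mem_voronoiCell_iff.2 (hw.cell x hcon))
  obtain ⟨i, hi⟩ := hi
  have hn := hw.norm_sq_pos i
  set κ : ℝ := (⟪w i, x⟫ - ‖w i‖ ^ 2 / 2) / ‖w i‖ ^ 2 with hκ
  have hκ0 : 0 < κ := div_pos (by linarith) hn
  -- `z` is orthogonal to `w i`, so `w i / 2 - ε • z` lies in the cell for small `ε`. Combining it
  -- with `x` by the weights `1 / (1 + ε)` and `ε / (1 + ε)` cancels `z` and leaves a point beyond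
  -- `w i / 2` on its ray, whence a segment longer than 1.
  set z : E := x - (1 / 2 : ℝ) • w i - κ • w i with hz
  have hzw : ⟪w i, -z⟫ ≤ 0 := by
    rw [inner_neg_right, hz, inner_sub_right, inner_sub_right, inner_smul_right, inner_smul_right,
      real_inner_self_eq_norm_sq, hκ, div_mul_cancel₀ _ hn.ne']
    linarith
  obtain ⟨ε, hε, hmem⟩ := hw.exists_half_add_mem i hzw
  have hp : (1 / 2 : ℝ) • w i + (ε * κ / (1 + ε)) • w i ∈ C' := by
    have h := hC'.1 (hsub.1 hmem) hx (by positivity : 0 ≤ 1 / (1 + ε))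
      (by positivity : 0 ≤ ε / (1 + ε)) (by field_simp)
    convert h using 1
    rw [hz]
    match_scalars
    · field_simp
      ring
    · field_simp
      ring
  have hpos : 0 < ε * κ / (1 + ε) := by positivity
  have := le_latticeDiameter hC'.2.1 hC'.1 (hsub.1 (hw.neg_half_mem i)) hp (hw.mem i)
    (hw.ne_zero i) (t := 1 + ε * κ / (1 + ε)) (by positivity) (by module)
  linarith

/-- These points are the vertices of the polar of the Voronoi cell. -/
theorem polarVertex_mem (hw : IsVoronoiRelevant L w) (i : ι) :
    (2 / ‖w i‖ ^ 2) • w i ∈ polarBody (voronoiCell L) := by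
  intro x hx
  have h := mem_voronoiCell_iff.1 hx (w i) (hw.mem i)
  have hn := hw.norm_sq_pos i
  rw [inner_smul_right, real_inner_comm, div_mul_eq_mul_div, div_le_one hn]
  linarith

theorem inner_le_two_of_mem_polarBody (hw : IsVoronoiRelevant L w) (i : ι) {y : E}
    (hy : y ∈ polarBody (voronoiCell L)) : ⟪w i, y⟫ ≤ 2 := by
  have := hy _ (hw.half_mem i)
  rw [inner_smul_left, conj_trivial] at this
  linarith

theorem neg_two_le_inner_of_mem_polarBody (hw : IsVoronoiRelevant L w) (i : ι) {y : E}
    (hy : y ∈ polarBody (voronoiCell L)) : -2 ≤ ⟪w i, y⟫ := by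
  have := hy _ (hw.neg_half_mem i)
  rw [inner_neg_left, inner_smul_left, conj_trivial] at this
  linarith

/-- The difference `z` is orthogonal to `w i`, so `w i / 2 + ε • z` is in the cell, and polarity
gives `1 + ε * ‖z‖ ^ 2 ≤ 1`. -/
theorem eq_polarVertex (hw : IsVoronoiRelevant L w) (i : ι) {y : E}
    (hy : y ∈ polarBody (voronoiCell L)) (h : ⟪w i, y⟫ = 2) :
    y = (2 / ‖w i‖ ^ 2) • w i := by
  have hn := hw.norm_sq_pos i
  set z := y - (2 / ‖w i‖ ^ 2) • w i with hz
  have hzw : ⟪w i, z⟫ = 0 := by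
    rw [hz, inner_sub_right, inner_smul_right, real_inner_self_eq_norm_sq, h,
      div_mul_cancel₀ _ hn.ne', sub_self]
  obtain ⟨ε, hε, hmem⟩ := hw.exists_half_add_mem i hzw.le
  have h1 := hy _ hmem
  rw [inner_add_left, inner_smul_left, inner_smul_left, conj_trivial, conj_trivial, h] at h1
  have h2 : ⟪z, y⟫ = ‖z‖ ^ 2 := by
    have hy' : y = z + (2 / ‖w i‖ ^ 2) • w i := by rw [hz]; abel
    conv_lhs => rw [hy']
    rw [inner_add_right, inner_smul_right, real_inner_comm (w i) z, hzw,
      real_inner_self_eq_norm_sq]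
    ring
  rw [h2] at h1
  have h3 : ‖z‖ ^ 2 ≤ 0 := by
    by_contra hlt
    rw [not_le] at hlt
    have := mul_pos hε hlt
    linarith
  have h4 : z = 0 := norm_eq_zero.1 (pow_eq_zero_iff two_ne_zero |>.1 (le_antisymm h3 (sq_nonneg _)))
  exact sub_eq_zero.1 h4

theorem polarBody_eq_convexHull (hw : IsVoronoiRelevant L w) :
    polarBody (voronoiCell L) =
      convexHull ℝ (Set.range fun i => (2 / ‖w i‖ ^ 2) • w i) := by
  set A := Set.range fun i => (2 / ‖w i‖ ^ 2) • w i with hA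
  have hconv : Convex ℝ (polarBody (voronoiCell L)) := by
    intro x hx y hy a b ha hb hab z hz
    rw [inner_add_right, inner_smul_right, inner_smul_right]
    have h1 := mul_le_mul_of_nonneg_left (hx z hz) ha
    have h2 := mul_le_mul_of_nonneg_left (hy z hz) hb
    linarith
  have hsub : convexHull ℝ A ⊆ polarBody (voronoiCell L) := by
    refine convexHull_min ?_ hconv
    rintro _ ⟨i, rfl⟩
    exact hw.polarVertex_mem i
  refine Set.Subset.antisymm (fun y hy => ?_) hsub
  by_contra hyA
  have hAc : IsCompact (convexHull ℝ A) := (Set.finite_range _).isCompact_convexHull ℝ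
  obtain ⟨f, s, hfs, hsy⟩ := geometric_hahn_banach_closed_point (convex_convexHull ℝ A)
    hAc.isClosed hyA
  have hmem : ∀ i, (2 / ‖w i‖ ^ 2) • w i ∈ convexHull ℝ A := fun i => subset_convexHull ℝ A ⟨i, rfl⟩
  have h0 : (0 : E) ∈ convexHull ℝ A := by
    obtain ⟨i⟩ := hw.nonempty
    obtain ⟨j, hj⟩ := hw.exists_neg i
    have h := convex_convexHull ℝ A (hmem i) (hmem j) (a := 1 / 2) (b := 1 / 2) (by norm_num)
      (by norm_num) (by norm_num)
    rwa [hj, norm_neg, smul_neg, smul_neg, add_neg_cancel] at h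
  have hs0 : 0 < s := by simpa using hfs 0 h0
  set u := (InnerProductSpace.toDual ℝ E).symm f
  have hu : ∀ x, ⟪u, x⟫ = f x := fun x => InnerProductSpace.toDual_symm_apply
  -- The separating functional, normalised by `s > 0`, satisfies every cell inequality, so it
  -- contradicts `y` being in the polar.
  have huV : (1 / s) • u ∈ voronoiCell L := by
    refine mem_voronoiCell_iff.2 (hw.cell _ fun i => ?_)
    have h1 := hfs _ (hmem i)
    have hn := hw.norm_sq_pos i
    rw [map_smul, smul_eq_mul, ← hu, div_mul_eq_mul_div, div_lt_iff₀ hn] at h1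
    rw [inner_smul_right, real_inner_comm, one_div, inv_mul_le_iff₀ hs0]
    linarith
  have h1 := hy _ huV
  rw [inner_smul_left, conj_trivial, hu, one_div, inv_mul_le_iff₀ hs0] at h1
  linarith

theorem isConvexBody_polarBody (hw : IsVoronoiRelevant L w) :
    IsConvexBody (polarBody (voronoiCell L)) := by
  refine ⟨?_, ?_, ?_⟩
  · rw [hw.polarBody_eq_convexHull]; exact convex_convexHull ℝ _
  · rw [hw.polarBody_eq_convexHull]; exact (Set.finite_range _).isCompact_convexHull ℝ
  · obtain ⟨R, hR, hVR⟩ := hw.bounded.exists_pos_norm_le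
    refine ⟨0, mem_interior_iff_mem_nhds.2 (Filter.mem_of_superset
      (Metric.closedBall_mem_nhds 0 (one_div_pos.2 hR)) fun y hy x hx => ?_)⟩
    rw [mem_closedBall_zero_iff] at hy
    calc ⟪x, y⟫ ≤ ‖x‖ * ‖y‖ := real_inner_le_norm x y
      _ ≤ R * (1 / R) := by gcongr; exact hVR x hx
      _ = 1 := by field_simp

/-- Since `y / 2` is not interior to the cell, some `i` has `‖w i‖ ^ 2 ≤ ⟪w i, y⟫`. The polar vertex
of `w i` and its opposite then differ by at least 4 along `y`. -/
theorem four_le_directionalWidth {C' : Set E} (hw : IsVoronoiRelevant L w) (hC' : IsCompact C')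
    (hmem : ∀ i, (2 / ‖w i‖ ^ 2) • w i ∈ C') {y : E} (hy : y ∈ L) (hy0 : y ≠ 0) :
    4 ≤ directionalWidth C' y := by
  have hex : ∃ i, ‖w i‖ ^ 2 ≤ ⟪w i, y⟫ := by
    by_contra! hcon
    have hi : (1 / 2 : ℝ) • y ∈ interior (voronoiCell L) := by
      rw [hw.voronoiCell_eq]
      refine mem_interior_polyhedron (Set.finite_range w) ?_
      rintro _ ⟨i, rfl⟩
      rw [inner_smul_right]
      linarith [hcon i]
    have hcont : Continuous fun ε : ℝ => (1 / 2 + ε) • y := by fun_prop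
    have hev : ∀ᶠ ε : ℝ in nhds 0, (1 / 2 + ε) • y ∈ voronoiCell L :=
      hcont.continuousAt.eventually_mem (by simpa using mem_interior_iff_mem_nhds.1 hi)
    obtain ⟨ε, h1, h2⟩ := ((hev.filter_mono nhdsWithin_le_nhds).and
      (self_mem_nhdsWithin (s := Set.Ioi (0 : ℝ)))).exists
    have h3 := mem_voronoiCell_iff.1 h1 y hy
    rw [inner_smul_right, real_inner_self_eq_norm_sq] at h3
    have h4 : 0 < ε * ‖y‖ ^ 2 := mul_pos h2 (pow_pos (norm_pos_iff.2 hy0) 2)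
    linarith
  obtain ⟨i, hi⟩ := hex
  obtain ⟨j, hj⟩ := hw.exists_neg i
  have hn := hw.norm_sq_pos i
  have h := inner_sub_le_directionalWidth hC' (hmem i) (hmem j) y
  rw [hj, norm_neg, smul_neg, sub_neg_eq_add, inner_add_right, inner_smul_right,
    real_inner_comm] at h
  have h2 : 2 ≤ 2 / ‖w i‖ ^ 2 * ⟪w i, y⟫ := by
    rw [div_mul_eq_mul_div, le_div_iff₀ hn]
    linarith
  linarith

/-- The polar lies in the slab `-2 ≤ ⟪w i, y⟫ ≤ 2`. A subbody of lattice width at least 4 must reach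
the value 2, which only the `i`-th vertex attains; so it contains all vertices. -/
theorem isLatticeReduced_polarBody {Λ : Submodule ℤ E} (hw : IsVoronoiRelevant (dualLattice Λ) w) :
    IsLatticeReduced Λ (polarBody (voronoiCell (dualLattice Λ))) := by
  have hbody := hw.isConvexBody_polarBody
  refine ⟨hbody, ?_⟩
  rintro ⟨C', hC', hsub, hd⟩
  have hwidth : 4 ≤ latticeWidth Λ (polarBody (voronoiCell (dualLattice Λ))) := by
    obtain ⟨i⟩ := hw.nonempty
    refine le_csInf ⟨_, w i, hw.mem i, hw.ne_zero i, rfl⟩ ?_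
    rintro _ ⟨y, hy, hy0, rfl⟩
    exact hw.four_le_directionalWidth hbody.2.1 hw.polarVertex_mem hy hy0
  refine hsub.2 ?_
  rw [hw.polarBody_eq_convexHull]
  refine convexHull_min ?_ hC'.1
  rintro _ ⟨i, rfl⟩
  have h1 := latticeWidth_le_directionalWidth hC'.2.1 hC'.nonempty (hw.mem i) (hw.ne_zero i)
  obtain ⟨a, ha, b, hb, hab⟩ := exists_directionalWidth_eq hC'.2.1 hC'.nonempty (w i)
  have h2 := hw.inner_le_two_of_mem_polarBody i (hsub.1 ha)
  have h3 := hw.neg_two_le_inner_of_mem_polarBody i (hsub.1 hb)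
  rw [inner_sub_right] at hab
  have h4 := hw.eq_polarVertex i (hsub.1 ha) (by linarith)
  change (2 / ‖w i‖ ^ 2) • w i ∈ C'
  rwa [← h4]

theorem polytopeVertices_polarBody (hw : IsVoronoiRelevant L w) :
    polytopeVertices (polarBody (voronoiCell L)) =
      Set.range fun i => (2 / ‖w i‖ ^ 2) • w i := by
  refine Set.Subset.antisymm ?_ ?_
  · rw [hw.polarBody_eq_convexHull]
    exact extremePoints_convexHull_subset
  · rintro _ ⟨i, rfl⟩
    have hn := hw.norm_sq_pos i
    refine ⟨hw.polarVertex_mem i, ?_⟩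
    rintro x hx y hy ⟨a, b, ha, hb, hab, he⟩
    refine hw.eq_polarVertex i hx ?_
    have h1 := hw.inner_le_two_of_mem_polarBody i hx
    have h2 := hw.inner_le_two_of_mem_polarBody i hy
    have h3 : a * ⟪w i, x⟫ + b * ⟪w i, y⟫ = 2 := by
      rw [← inner_smul_right, ← inner_smul_right, ← inner_add_right, he, inner_smul_right,
        real_inner_self_eq_norm_sq, div_mul_cancel₀ _ hn.ne']
    refine le_antisymm h1 ?_
    by_contra hlt
    rw [not_le] at hlt
    have h4 := mul_lt_mul_of_pos_left hlt ha
    have h5 := mul_le_mul_of_nonneg_left h2 hb.le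
    have h6 : a * 2 + b * 2 = 2 := by rw [← add_mul, hab, one_mul]
    linarith

theorem encard_polytopeVertices_polarBody (hw : IsVoronoiRelevant L w) :
    (polytopeVertices (polarBody (voronoiCell L))).encard = Nat.card ι := by
  have hinj : Function.Injective fun i => (2 / ‖w i‖ ^ 2) • w i := by
    intro i j hij
    have hn := hw.norm_sq_pos i
    by_contra hne
    have h1 : ⟪w j, (2 / ‖w i‖ ^ 2) • w i⟫ = 2 := by
      simp only at hij
      rw [hij, inner_smul_right, real_inner_self_eq_norm_sq,
        div_mul_cancel₀ _ (hw.norm_sq_pos j).ne']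
    rw [inner_smul_right, div_mul_eq_mul_div, div_eq_iff hn.ne'] at h1
    linarith [hw.inner_lt j i (Ne.symm hne)]
  rw [hw.polytopeVertices_polarBody, ← Set.image_univ, hinj.encard_image, Set.encard_univ,
    ENat.card_eq_coe_natCard]

end IsVoronoiRelevant

end Voronoi

/-! ### The lattice `A_d` and the Voronoi cell of its dual -/

section RootLattice

variable {d : ℕ}

theorem SumZeroSpace.sum_eq_zero (x : SumZeroSpace d) :
    ∑ i, (x : EuclideanSpace ℝ (Fin (d + 1))) i = 0 := by
  have h := x.2
  rw [Submodule.mem_orthogonal_singleton_iff_inner_right] at h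
  simpa [PiLp.inner_apply] using h

/-- The vector with given coordinates of sum zero. -/
def SumZeroSpace.mk (f : Fin (d + 1) → ℝ) (hf : ∑ i, f i = 0) : SumZeroSpace d :=
  ⟨WithLp.toLp 2 f, by
    rw [Submodule.mem_orthogonal_singleton_iff_inner_right]
    simpa [PiLp.inner_apply] using hf⟩

theorem SumZeroSpace.mk_apply (f : Fin (d + 1) → ℝ) (hf : ∑ i, f i = 0) (i : Fin (d + 1)) :
    (SumZeroSpace.mk f hf : EuclideanSpace ℝ (Fin (d + 1))) i = f i := rfl

theorem SumZeroSpace.inner_eq_sum (x y : SumZeroSpace d) :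
    ⟪x, y⟫ = ∑ i, (x : EuclideanSpace ℝ (Fin (d + 1))) i *
      (y : EuclideanSpace ℝ (Fin (d + 1))) i := by
  rw [Submodule.coe_inner, PiLp.inner_apply]
  simp [mul_comm]

theorem SumZeroSpace.ext {x y : SumZeroSpace d}
    (h : ∀ i, (x : EuclideanSpace ℝ (Fin (d + 1))) i = (y : EuclideanSpace ℝ (Fin (d + 1))) i) :
    x = y := by
  apply Subtype.ext
  ext i
  exact h i

/-- The root `e_i - e_j`. -/
def rootVector (i j : Fin (d + 1)) : SumZeroSpace d :=
  SumZeroSpace.mk (fun k => (if k = i then 1 else 0) - (if k = j then 1 else 0)) (by simp)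

theorem rootVector_mem (i j : Fin (d + 1)) : rootVector i j ∈ rootLatticeA d := by
  intro k
  refine ⟨(if k = i then 1 else 0) - (if k = j then 1 else 0), ?_⟩
  simp [rootVector, SumZeroSpace.mk_apply]

theorem inner_rootVector (i j : Fin (d + 1)) (y : SumZeroSpace d) :
    ⟪rootVector i j, y⟫ = (y : EuclideanSpace ℝ (Fin (d + 1))) i -
      (y : EuclideanSpace ℝ (Fin (d + 1))) j := by
  rw [SumZeroSpace.inner_eq_sum]
  simp [rootVector, SumZeroSpace.mk_apply, sub_mul, Finset.sum_sub_distrib]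

theorem mem_dualLattice_rootLatticeA {y : SumZeroSpace d} :
    y ∈ dualLattice (rootLatticeA d) ↔ ∀ i j, ∃ n : ℤ,
      (y : EuclideanSpace ℝ (Fin (d + 1))) i - (y : EuclideanSpace ℝ (Fin (d + 1))) j = n := by
  rw [mem_dualLattice]
  constructor
  · intro h i j
    obtain ⟨n, hn⟩ := h _ (rootVector_mem i j)
    exact ⟨n, by rw [← hn, inner_rootVector]⟩
  · intro h x hx
    choose m hm using hx
    choose n hn using fun i => h i 0
    refine ⟨∑ i, m i * n i, ?_⟩
    push_cast
    simp_rw [← hm, ← hn, mul_sub, Finset.sum_sub_distrib, ← Finset.sum_mul, x.sum_eq_zero,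
      SumZeroSpace.inner_eq_sum]
    simp

theorem SumZeroSpace.abs_apply_le_norm (x : SumZeroSpace d) (i : Fin (d + 1)) :
    |(x : EuclideanSpace ℝ (Fin (d + 1))) i| ≤ ‖x‖ := by
  rw [Submodule.coe_norm, ← Real.norm_eq_abs]
  exact PiLp.norm_apply_le _ i

instance rootLatticeA_discreteTopology : DiscreteTopology (rootLatticeA d) := by
  refine discreteTopology_of_isOpen_singleton_zero ?_
  rw [Metric.isOpen_iff]
  rintro _ rfl
  refine ⟨1, one_pos, fun x hx => ?_⟩
  rw [mem_ball_zero_iff] at hx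
  refine Subtype.ext (SumZeroSpace.ext fun i => ?_)
  obtain ⟨n, hn⟩ := x.2 i
  have h := (SumZeroSpace.abs_apply_le_norm (x : SumZeroSpace d) i).trans_lt hx
  rw [hn] at h
  have h0 : n = 0 := Int.abs_lt_one_iff.1 
    ((Int.cast_lt (R := ℝ)).1 (by rw [Int.cast_abs, Int.cast_one]; exact h))
  simp [hn, h0]

instance rootLatticeA_isZLattice : IsZLattice ℝ (rootLatticeA d) := by
  refine ⟨eq_top_iff.2 fun x _ => ?_⟩
  have hx : x = ∑ i, (x : EuclideanSpace ℝ (Fin (d + 1))) i • rootVector i 0 := by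
    refine SumZeroSpace.ext fun k => ?_
    simp [rootVector, SumZeroSpace.mk_apply, mul_sub, Finset.sum_sub_distrib,
      x.sum_eq_zero]
  rw [hx]
  exact Submodule.sum_mem _ fun i _ => Submodule.smul_mem _ _
    (Submodule.subset_span (rootVector_mem i 0))

theorem finrank_sumZeroSpace : Module.finrank ℝ (SumZeroSpace d) = d := by
  have h0 : (WithLp.toLp 2 (fun _ : Fin (d + 1) => (1 : ℝ))) ≠ 0 := by
    intro h
    have := congrArg (fun x : EuclideanSpace ℝ (Fin (d + 1)) => x 0) h
    simp at this
  have h := finrank_orthogonal_singleton_add_one h0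
  rw [finrank_euclideanSpace, Fintype.card_fin] at h
  exact Nat.add_right_cancel h

/-- The projection of the indicator vector of `S` to the sum-zero hyperplane. -/
noncomputable def subsetVector (S : Finset (Fin (d + 1))) : SumZeroSpace d :=
  SumZeroSpace.mk (fun k => (if k ∈ S then 1 else 0) - (S.card : ℝ) / (d + 1)) (by
    rw [Finset.sum_sub_distrib]
    simp
    field_simp
    simp)

theorem subsetVector_apply (S : Finset (Fin (d + 1))) (k : Fin (d + 1)) :
    (subsetVector S : EuclideanSpace ℝ (Fin (d + 1))) k =
      (if k ∈ S then 1 else 0) - (S.card : ℝ) / (d + 1) := rfl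

theorem inner_subsetVector (S : Finset (Fin (d + 1))) (x : SumZeroSpace d) :
    ⟪subsetVector S, x⟫ = ∑ i ∈ S, (x : EuclideanSpace ℝ (Fin (d + 1))) i := by
  rw [SumZeroSpace.inner_eq_sum]
  simp_rw [subsetVector_apply, sub_mul, Finset.sum_sub_distrib, ← Finset.mul_sum, x.sum_eq_zero]
  simp

theorem subsetVector_mem (S : Finset (Fin (d + 1))) :
    subsetVector S ∈ dualLattice (rootLatticeA d) := by
  rw [mem_dualLattice_rootLatticeA]
  intro i j
  refine ⟨(if i ∈ S then 1 else 0) - (if j ∈ S then 1 else 0), ?_⟩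
  simp [subsetVector_apply]

theorem inner_subsetVector_subsetVector (S T : Finset (Fin (d + 1))) :
    ⟪subsetVector S, subsetVector T⟫ =
      ((S ∩ T).card : ℝ) - (S.card : ℝ) * T.card / (d + 1) := by
  rw [inner_subsetVector]
  simp_rw [subsetVector_apply, Finset.sum_sub_distrib]
  simp
  ring

theorem norm_sq_subsetVector (S : Finset (Fin (d + 1))) :
    ‖subsetVector S‖ ^ 2 = (S.card : ℝ) - (S.card : ℝ) ^ 2 / (d + 1) := by
  rw [← real_inner_self_eq_norm_sq, inner_subsetVector_subsetVector, Finset.inter_self, sq]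

theorem subsetVector_compl (S : Finset (Fin (d + 1))) : subsetVector Sᶜ = -subsetVector S := by
  refine SumZeroSpace.ext fun k => ?_
  have h : (Sᶜ.card : ℝ) = d + 1 - S.card := by
    rw [Finset.card_compl, Nat.cast_sub (Finset.card_le_univ S)]
    simp
  simp only [Submodule.coe_neg, PiLp.neg_apply, subsetVector_apply, h, Finset.mem_compl]
  split_ifs <;> field_simp <;> simp_all

theorem card_pos_of_ne_empty_univ {S : Finset (Fin (d + 1))} (h : S ≠ ∅ ∧ S ≠ Finset.univ) :
    0 < (S.card : ℝ) ∧ (S.card : ℝ) < d + 1 := by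
  refine ⟨by exact_mod_cast (Finset.nonempty_iff_ne_empty.2 h.1).card_pos, ?_⟩
  have := Finset.card_lt_univ_of_notMem (s := S) (x := ?_) ?_
  · rw [Fintype.card_fin] at this
    exact_mod_cast this
  · exact (not_forall.1 (fun hall => h.2 (Finset.eq_univ_of_forall hall))).choose
  · exact (not_forall.1 (fun hall => h.2 (Finset.eq_univ_of_forall hall))).choose_spec

/-- Up to the factor `d + 1`, the gap is `(d + 1 - |T|) (|T| - |S ∩ T|) + |T| (|S| - |S ∩ T|)`,
which vanishes only for `S = T`. -/
theorem inner_subsetVector_lt {S T : Finset (Fin (d + 1))} (hT : T ≠ ∅ ∧ T ≠ Finset.univ)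
    (hST : S ≠ T) : ⟪subsetVector S, subsetVector T⟫ < ‖subsetVector T‖ ^ 2 := by
  rw [inner_subsetVector_subsetVector, norm_sq_subsetVector]
  obtain ⟨h1, h2⟩ := card_pos_of_ne_empty_univ hT
  have hcS : ((S ∩ T).card : ℝ) ≤ S.card := by
    exact_mod_cast Finset.card_le_card Finset.inter_subset_left
  have hcT : ((S ∩ T).card : ℝ) ≤ T.card := by
    exact_mod_cast Finset.card_le_card Finset.inter_subset_right
  have hn : (0 : ℝ) < d + 1 := by positivity
  have key : 0 < ((d + 1 : ℝ) - T.card) * (T.card - (S ∩ T).card) +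
      T.card * (S.card - (S ∩ T).card) := by
    rcases hcT.lt_or_eq with hlt | heq
    · have := mul_pos (sub_pos.2 h2) (sub_pos.2 hlt)
      have := mul_nonneg h1.le (sub_nonneg.2 hcS)
      linarith
    · have hTS : T ⊆ S := by
        have : S ∩ T = T := Finset.eq_of_subset_of_card_le Finset.inter_subset_right
          (by exact_mod_cast heq.ge)
        exact Finset.inter_eq_right.1 this
      have hlt : ((S ∩ T).card : ℝ) < S.card := by
        rw [heq]
        exact_mod_cast Finset.card_lt_card (hTS.ssubset_of_ne (Ne.symm hST))
      rw [heq, sub_self, mul_zero, zero_add]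
      rw [heq] at hlt
      exact mul_pos h1 (sub_pos.2 hlt)
  have h3 : (T.card : ℝ) - (T.card : ℝ) ^ 2 / (d + 1) -
      (((S ∩ T).card : ℝ) - (S.card : ℝ) * T.card / (d + 1)) =
      (((d + 1 : ℝ) - T.card) * (T.card - (S ∩ T).card) +
        T.card * (S.card - (S ∩ T).card)) / (d + 1) := by
    field_simp
    ring
  have := div_pos key hn
  linarith

/-- A dual vector of `A_d` is a sum of vectors `subsetVector S` along a chain of subsets, whose
pairwise inner products are non-negative; so these vectors cut out the Voronoi cell. -/
theorem inner_le_of_forall_subsetVector {x : SumZeroSpace d}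
    (hx : ∀ S : Finset (Fin (d + 1)), S ≠ ∅ ∧ S ≠ Finset.univ →
      ⟪subsetVector S, x⟫ ≤ ‖subsetVector S‖ ^ 2 / 2) (N : ℕ) (a : SumZeroSpace d)
    (ha : a ∈ dualLattice (rootLatticeA d)) (i₀ : Fin (d + 1))
    (hmin : ∀ i, (a : EuclideanSpace ℝ (Fin (d + 1))) i₀ ≤ (a : EuclideanSpace ℝ (Fin (d + 1))) i)
    (hN : ∑ i, ((a : EuclideanSpace ℝ (Fin (d + 1))) i -
      (a : EuclideanSpace ℝ (Fin (d + 1))) i₀) < N) :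
    ⟪a, x⟫ ≤ ‖a‖ ^ 2 / 2 := by
  classical
  induction N generalizing a with
  | zero =>
    have := Finset.sum_nonneg fun i (_ : i ∈ Finset.univ) => sub_nonneg.2 (hmin i)
    simp only [Nat.cast_zero] at hN
    linarith
  | succ N ih =>
    -- Subtracting the vector of the set `S` of coordinates above the minimum lowers each of these
    -- gaps by 1. As the gaps are integers, `i₀` stays minimal, and the sum bounded by `N` drops by
    -- `|S| ≥ 1`.
    let S : Finset (Fin (d + 1)) := Finset.univ.filter fun i =>
      (a : EuclideanSpace ℝ (Fin (d + 1))) i₀ < (a : EuclideanSpace ℝ (Fin (d + 1))) i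
    have hS : ∀ i, i ∈ S ↔ (a : EuclideanSpace ℝ (Fin (d + 1))) i₀ <
        (a : EuclideanSpace ℝ (Fin (d + 1))) i := fun i => by simp [S]
    by_cases hSe : S = ∅
    · have hall : ∀ i, (a : EuclideanSpace ℝ (Fin (d + 1))) i =
          (a : EuclideanSpace ℝ (Fin (d + 1))) i₀ := fun i =>
        le_antisymm (not_lt.1 fun h => by simpa [hSe] using (hS i).2 h) (hmin i)
      have hsum := a.sum_eq_zero
      rw [Finset.sum_congr rfl fun i _ => hall i, Finset.sum_const, Finset.card_univ,
        Fintype.card_fin, nsmul_eq_mul] at hsum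
      have h0 : (a : EuclideanSpace ℝ (Fin (d + 1))) i₀ = 0 :=
        (mul_eq_zero.1 hsum).resolve_left (by positivity)
      have ha0 : a = 0 := SumZeroSpace.ext fun i => by rw [hall i, h0]; rfl
      simp [ha0]
    · have hi₀ : i₀ ∉ S := fun h => lt_irrefl _ ((hS i₀).1 h)
      have hSu : S ≠ Finset.univ := fun h => hi₀ (h ▸ Finset.mem_univ _)
      obtain ⟨hc1, hc2⟩ := card_pos_of_ne_empty_univ ⟨hSe, hSu⟩
      set a' := a - subsetVector S with ha'
      have hcoord : ∀ i, (a' : EuclideanSpace ℝ (Fin (d + 1))) i -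
          (a' : EuclideanSpace ℝ (Fin (d + 1))) i₀ =
          (a : EuclideanSpace ℝ (Fin (d + 1))) i - (a : EuclideanSpace ℝ (Fin (d + 1))) i₀ -
          (if i ∈ S then 1 else 0) := by
        intro i
        simp only [ha', Submodule.coe_sub, PiLp.sub_apply, subsetVector_apply, hi₀, if_false]
        ring
      have hmin' : ∀ i, (a' : EuclideanSpace ℝ (Fin (d + 1))) i₀ ≤
          (a' : EuclideanSpace ℝ (Fin (d + 1))) i := by
        intro i
        rw [← sub_nonneg, hcoord]
        split_ifs with h
        · obtain ⟨n, hn⟩ := mem_dualLattice_rootLatticeA.1 ha i i₀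
          have h1 := sub_pos.2 ((hS i).1 h)
          rw [hn] at h1 ⊢
          have h2 : (1 : ℤ) ≤ n := Int.cast_pos.1 h1
          have h3 : (1 : ℝ) ≤ n := by exact_mod_cast h2
          linarith
        · linarith [hmin i]
      have hsum' : ∑ i, ((a' : EuclideanSpace ℝ (Fin (d + 1))) i -
          (a' : EuclideanSpace ℝ (Fin (d + 1))) i₀) =
          ∑ i, ((a : EuclideanSpace ℝ (Fin (d + 1))) i -
            (a : EuclideanSpace ℝ (Fin (d + 1))) i₀) - S.card := by
        rw [Finset.sum_congr rfl fun i _ => hcoord i, Finset.sum_sub_distrib]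
        simp
      have hcard : (1 : ℝ) ≤ S.card := by
        exact_mod_cast (Finset.nonempty_iff_ne_empty.2 hSe).card_pos
      have h1 := ih a' (sub_mem ha (subsetVector_mem S)) hmin' (by
        rw [hsum']
        push_cast at hN
        linarith)
      have h2 := hx S ⟨hSe, hSu⟩
      have haa : a = a' + subsetVector S := by rw [ha']; abel
      -- Off `S` the coordinates of `a'` equal the minimum `m`, so this inner product is `-(d + 1 -
      -- |S|) m`, and `m ≤ 0` because the coordinates sum to zero.
      have hcross : 0 ≤ ⟪a', subsetVector S⟫ := by
        rw [real_inner_comm, inner_subsetVector]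
        set m := (a' : EuclideanSpace ℝ (Fin (d + 1))) i₀ with hm
        have e1 : ∑ i ∈ S, ((a' : EuclideanSpace ℝ (Fin (d + 1))) i - m) =
            ∑ i, ((a' : EuclideanSpace ℝ (Fin (d + 1))) i - m) := by
          refine Finset.sum_subset (Finset.subset_univ S) fun i _ hi => ?_
          have h3 := (hS i).not.1 hi
          rw [hm, hcoord, if_neg hi, le_antisymm (not_lt.1 h3) (hmin i)]
          ring
        have e2 : 0 ≤ ∑ i, ((a' : EuclideanSpace ℝ (Fin (d + 1))) i - m) :=
          Finset.sum_nonneg fun i _ => sub_nonneg.2 (hmin' i)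
        rw [Finset.sum_sub_distrib, Finset.sum_sub_distrib, a'.sum_eq_zero] at e1
        rw [Finset.sum_sub_distrib, a'.sum_eq_zero] at e2
        simp only [Finset.sum_const, Finset.card_univ, Fintype.card_fin, nsmul_eq_mul] at e1 e2
        push_cast at e1 e2
        have hm0 : m ≤ 0 := by
          by_contra hlt
          rw [not_le] at hlt
          have : 0 < ((d : ℝ) + 1) * m := by positivity
          linarith
        have : 0 ≤ ((d : ℝ) + 1 - S.card) * (-m) := mul_nonneg (by linarith) (by linarith)
        linarith
      rw [haa, inner_add_left, norm_add_sq_real]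
      linarith

/-- The non-empty proper subsets of `Fin (d + 1)`, the index set of the Voronoi relevant vectors
of the dual of `A_d`. -/
abbrev ProperSubset (d : ℕ) : Type :=
  {S : Finset (Fin (d + 1)) // S ≠ ∅ ∧ S ≠ Finset.univ}

theorem card_properSubset : Nat.card (ProperSubset d) = 2 ^ (d + 1) - 2 := by
  classical
  rw [Nat.card_eq_fintype_card, Fintype.card_subtype]
  have : (Finset.univ.filter fun S : Finset (Fin (d + 1)) => S ≠ ∅ ∧ S ≠ Finset.univ) =
      (Finset.univ.erase ∅).erase Finset.univ := by
    ext S; simp [and_comm]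
  rw [this, Finset.card_erase_of_mem (by simp [Finset.univ_nonempty.ne_empty]),
    Finset.card_erase_of_mem (Finset.mem_univ _)]
  simp
  omega

theorem bounded_voronoiCell_dual_rootLatticeA :
    Bornology.IsBounded (voronoiCell (dualLattice (rootLatticeA d))) := by
  refine isBounded_iff_forall_norm_le.2 ⟨√(d + 1), fun x hx => ?_⟩
  rw [mem_voronoiCell_iff] at hx
  have key : ∀ i, (x : EuclideanSpace ℝ (Fin (d + 1))) i *
      (x : EuclideanSpace ℝ (Fin (d + 1))) i ≤ 1 := by
    intro i
    have h1 := hx _ (subsetVector_mem {i})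
    have h2 := hx _ (neg_mem (subsetVector_mem {i}))
    rw [inner_neg_left, norm_neg] at h2
    rw [norm_sq_subsetVector, inner_subsetVector] at h1 h2
    simp only [Finset.sum_singleton, Finset.card_singleton, Nat.cast_one, one_pow] at h1 h2
    have h3 : (0 : ℝ) ≤ 1 / (d + 1) := by positivity
    nlinarith
  refine Real.le_sqrt_of_sq_le ?_
  rw [← real_inner_self_eq_norm_sq, SumZeroSpace.inner_eq_sum]
  calc _ ≤ ∑ _i : Fin (d + 1), (1 : ℝ) := Finset.sum_le_sum fun i _ => key i
    _ = d + 1 := by simp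

theorem isVoronoiRelevant_subsetVector (hd : 1 ≤ d) :
    IsVoronoiRelevant (dualLattice (rootLatticeA d))
      fun S : ProperSubset d => subsetVector S.1 where
  mem S := subsetVector_mem S.1
  ne_zero S h := by
    have h1 := norm_sq_subsetVector S.1
    obtain ⟨h2, h3⟩ := card_pos_of_ne_empty_univ S.2
    rw [h, norm_zero] at h1
    field_simp at h1
    nlinarith
  inner_lt S T h := inner_subsetVector_lt T.2 fun e => h (Subtype.ext e)
  exists_neg S := ⟨⟨S.1ᶜ, by simpa [Finset.compl_eq_empty_iff, and_comm] using S.2⟩,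
    subsetVector_compl S.1⟩
  cell x hx a ha := by
    obtain ⟨i₀, -, hi₀⟩ := Finset.exists_min_image Finset.univ
      (fun i => (a : EuclideanSpace ℝ (Fin (d + 1))) i) Finset.univ_nonempty
    obtain ⟨N, hN⟩ := exists_nat_gt (∑ i, ((a : EuclideanSpace ℝ (Fin (d + 1))) i -
      (a : EuclideanSpace ℝ (Fin (d + 1))) i₀))
    exact inner_le_of_forall_subsetVector (fun S hS => hx ⟨S, hS⟩) N a ha i₀
      (fun i => hi₀ i (Finset.mem_univ i)) hN
  bounded := bounded_voronoiCell_dual_rootLatticeA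
  nonempty := ⟨⟨{0}, Finset.singleton_ne_empty 0, fun h => by
    have := congrArg Finset.card h
    rw [Finset.card_singleton, Finset.card_univ, Fintype.card_fin] at this
    omega⟩⟩

end RootLattice

/-! ### Invariance under linear isomorphisms of lattices -/

section Transport

variable {E F : Type*} [NormedAddCommGroup E] [InnerProductSpace ℝ E]
  [NormedAddCommGroup F] [InnerProductSpace ℝ F]

theorem IsConvexBody.image {C : Set E} (hC : IsConvexBody C) (T : E ≃L[ℝ] F) :
    IsConvexBody (T '' C) := by
  refine ⟨hC.1.linear_image (T : E →ₗ[ℝ] F), hC.2.1.image T.continuous, ?_⟩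
  have h : T '' interior C = interior (T '' C) := T.toHomeomorph.image_interior C
  exact h ▸ hC.2.2.image T

theorem image_ssubset_of_ssubset_image {C : Set E} {C' : Set F} (T : E ≃L[ℝ] F) (h : C' ⊂ T '' C) :
    T.symm '' C' ⊂ C := by
  have := T.symm.injective.image_strictMono h
  rwa [T.symm_image_image] at this

theorem ssubset_image_of_image_ssubset {C : Set E} {C' : Set F} (T : E ≃L[ℝ] F) (h : T '' C ⊂ C') :
    C ⊂ T.symm '' C' := by
  have := T.symm.injective.image_strictMono h
  rwa [T.symm_image_image] at this

theorem symm_mem_iff {Λ : Submodule ℤ E} {M : Submodule ℤ F} (T : E ≃L[ℝ] F)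
    (hT : ∀ x, T x ∈ M ↔ x ∈ Λ) (y : F) : T.symm y ∈ Λ ↔ y ∈ M := by
  rw [← hT, T.apply_symm_apply]

section Width

variable [FiniteDimensional ℝ E] [FiniteDimensional ℝ F]

/-- The adjoint of `T` carries the dual of `M` into the dual of `Λ` and preserves widths. The
reverse inclusion is the same statement for `T.symm`. -/
theorem latticeWidth_image_subset {Λ : Submodule ℤ E} {M : Submodule ℤ F} (T : E ≃L[ℝ] F)
    (hT : ∀ x, T x ∈ M ↔ x ∈ Λ) (C : Set E) :
    {r : ℝ | ∃ y ∈ dualLattice M, y ≠ 0 ∧ r = directionalWidth (T '' C) y} ⊆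
      {r : ℝ | ∃ y ∈ dualLattice Λ, y ≠ 0 ∧ r = directionalWidth C y} := by
  rintro _ ⟨y, hy, hy0, rfl⟩
  let A := LinearMap.adjoint (T : E →ₗ[ℝ] F)
  have hA : ∀ x, ⟪x, A y⟫ = ⟪T x, y⟫ := fun x => LinearMap.adjoint_inner_right _ x y
  refine ⟨A y, ?_, ?_, ?_⟩
  · rw [mem_dualLattice] at hy ⊢
    intro x hx
    rw [hA]
    exact hy _ ((hT x).2 hx)
  · intro h
    have := hA (T.symm y)
    rw [h, inner_zero_right, T.apply_symm_apply] at this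
    exact hy0 (inner_self_eq_zero.1 this.symm)
  · have hA' : ∀ x, ⟪A y, x⟫ = ⟪y, T x⟫ := fun x => by
      rw [real_inner_comm, hA, real_inner_comm]
    simp only [directionalWidth, Set.exists_mem_image, hA', map_sub]

theorem latticeWidth_image {Λ : Submodule ℤ E} {M : Submodule ℤ F} (T : E ≃L[ℝ] F)
    (hT : ∀ x, T x ∈ M ↔ x ∈ Λ) (C : Set E) : latticeWidth M (T '' C) = latticeWidth Λ C := by
  rw [latticeWidth, latticeWidth]
  congr 1
  refine (latticeWidth_image_subset T hT C).antisymm ?_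
  have := latticeWidth_image_subset T.symm (symm_mem_iff T hT) (T '' C)
  rwa [T.symm_image_image] at this

theorem IsLatticeReduced.image {Λ : Submodule ℤ E} {M : Submodule ℤ F} {C : Set E}
    (hC : IsLatticeReduced Λ C) (T : E ≃L[ℝ] F) (hT : ∀ x, T x ∈ M ↔ x ∈ Λ) :
    IsLatticeReduced M (T '' C) := by
  refine ⟨hC.1.image T, ?_⟩
  rintro ⟨C', hC', hsub, hw⟩
  refine hC.2 ⟨T.symm '' C', hC'.image T.symm, image_ssubset_of_ssubset_image T hsub, ?_⟩
  rw [latticeWidth_image T.symm (symm_mem_iff T hT), hw, latticeWidth_image T hT]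

end Width

theorem IsPrimitiveVector.symm_apply {Λ : Submodule ℤ E} {M : Submodule ℤ F} (T : E ≃L[ℝ] F)
    (hT : ∀ x, T x ∈ M ↔ x ∈ Λ) {v : F} (hv : IsPrimitiveVector M v) :
    IsPrimitiveVector Λ (T.symm v) := by
  refine ⟨(symm_mem_iff T hT v).2 hv.1, by simpa using hv.2.1, fun t ht ht1 h => ?_⟩
  rw [← map_smul, symm_mem_iff T hT] at h
  exact hv.2.2 t ht ht1 h

theorem latticeDiameter_image_subset {Λ : Submodule ℤ E} {M : Submodule ℤ F} (T : E ≃L[ℝ] F)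
    (hT : ∀ x, T x ∈ M ↔ x ∈ Λ) (C : Set E) :
    {r : ℝ | ∃ a b v : F, segment ℝ a b ⊆ T '' C ∧ IsPrimitiveDirection M a b v ∧
      r = ‖b - a‖ / ‖v‖} ⊆
    {r : ℝ | ∃ a b v : E, segment ℝ a b ⊆ C ∧ IsPrimitiveDirection Λ a b v ∧
      r = ‖b - a‖ / ‖v‖} := by
  rintro _ ⟨a, b, v, hab, ⟨hv, t, ht, he⟩, rfl⟩
  have hv' := hv.symm_apply T hT
  have he' : T.symm b - T.symm a = t • T.symm v := by rw [← map_sub, he, map_smul]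
  refine ⟨T.symm a, T.symm b, T.symm v, ?_, ⟨hv', t, ht, he'⟩, ?_⟩
  · have h := Set.image_mono (f := T.symm) hab
    rw [T.symm_image_image] at h
    exact (image_segment ℝ (T.symm : F →ₗ[ℝ] E).toAffineMap a b).symm.subset.trans h
  · rw [norm_sub_div_norm_eq hv.2.1 ht he, norm_sub_div_norm_eq hv'.2.1 ht he']

theorem latticeDiameter_image {Λ : Submodule ℤ E} {M : Submodule ℤ F} (T : E ≃L[ℝ] F)
    (hT : ∀ x, T x ∈ M ↔ x ∈ Λ) (C : Set E) :
    latticeDiameter M (T '' C) = latticeDiameter Λ C := by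
  rw [latticeDiameter, latticeDiameter]
  congr 1
  refine (latticeDiameter_image_subset T hT C).antisymm ?_
  have := latticeDiameter_image_subset T.symm (symm_mem_iff T hT) (T '' C)
  rwa [T.symm_image_image] at this

theorem IsLatticeComplete.image {Λ : Submodule ℤ E} {M : Submodule ℤ F} {C : Set E}
    (hC : IsLatticeComplete Λ C) (T : E ≃L[ℝ] F) (hT : ∀ x, T x ∈ M ↔ x ∈ Λ) :
    IsLatticeComplete M (T '' C) := by
  refine ⟨hC.1.image T, ?_⟩
  rintro ⟨C', hC', hsub, hw⟩
  refine hC.2 ⟨T.symm '' C', hC'.image T.symm, ssubset_image_of_image_ssubset T hsub, ?_⟩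
  rw [latticeDiameter_image T.symm (symm_mem_iff T hT), hw, latticeDiameter_image T hT]

theorem encard_polytopeVertices_image (T : E ≃L[ℝ] F) (C : Set E) :
    (polytopeVertices (T '' C)).encard = (polytopeVertices C).encard := by
  rw [polytopeVertices, polytopeVertices, ← image_extremePoints (𝕜 := ℝ) T, T.injective.encard_image]

theorem finrank_vectorSpan_image (T : E ≃L[ℝ] F) (C : Set E) :
    Module.finrank ℝ (vectorSpan ℝ (T '' C)) = Module.finrank ℝ (vectorSpan ℝ C) := by
  have h := (T : E →ₗ[ℝ] F).toAffineMap.map_vectorSpan (s := C)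
  have h' : vectorSpan ℝ (T '' C) = (vectorSpan ℝ C).map (T.toLinearEquiv : E →ₗ[ℝ] F) := h.symm
  rw [h', LinearEquiv.finrank_map_eq]

theorem image_mem_polytopeFacets (T : E ≃L[ℝ] F) {C G : Set E} (hG : G ∈ polytopeFacets C) :
    T '' G ∈ polytopeFacets (T '' C) := by
  refine ⟨hG.1.image T, hG.2.1.linear_image (T : E →ₗ[ℝ] F),
    ⟨Set.image_mono hG.2.2.1.1, ?_⟩, ?_⟩
  · rintro _ ⟨x, hx, rfl⟩ _ ⟨y, hy, rfl⟩ _ ⟨z, hz, rfl⟩ hzxy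
    refine Set.mem_image_of_mem T (hG.2.2.1.2 hx hy hz ?_)
    obtain ⟨a, b, ha, hb, hab, he⟩ := hzxy
    refine ⟨a, b, ha, hb, hab, T.injective ?_⟩
    rw [map_add, map_smul, map_smul, he]
  · rw [finrank_vectorSpan_image, finrank_vectorSpan_image, hG.2.2.2]

theorem encard_polytopeFacets_image (T : E ≃L[ℝ] F) (C : Set E) :
    (polytopeFacets (T '' C)).encard = (polytopeFacets C).encard := by
  have h : polytopeFacets (T '' C) = Set.image T '' polytopeFacets C := by
    refine Set.Subset.antisymm (fun G hG => ?_) ?_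
    · refine ⟨T.symm '' G, ?_, T.image_symm_image G⟩
      have := image_mem_polytopeFacets T.symm hG
      rwa [T.symm_image_image] at this
    · rintro _ ⟨G, hG, rfl⟩
      exact image_mem_polytopeFacets T hG
  rw [h, T.injective.image_injective.encard_image]

/-- Any two lattices of the same dimension are related by a linear isomorphism. -/
theorem exists_continuousLinearEquiv_mem_iff [FiniteDimensional ℝ E] [FiniteDimensional ℝ F]
    (Λ : Submodule ℤ E) [DiscreteTopology Λ] [IsZLattice ℝ Λ] (M : Submodule ℤ F)
    [DiscreteTopology M] [IsZLattice ℝ M] (h : Module.finrank ℝ E = Module.finrank ℝ F) :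
    ∃ T : E ≃L[ℝ] F, ∀ x, T x ∈ M ↔ x ∈ Λ := by
  let b₁ := Module.finBasisOfFinrankEq ℤ Λ ((ZLattice.rank ℝ Λ).trans h)
  let b₂ := Module.finBasisOfFinrankEq ℤ M (ZLattice.rank ℝ M)
  let c₁ := b₁.ofZLatticeBasis ℝ Λ
  let c₂ := b₂.ofZLatticeBasis ℝ M
  refine ⟨(c₁.equiv c₂ (Equiv.refl _)).toContinuousLinearEquiv, fun x => ?_⟩
  have h₁ : Submodule.span ℤ (Set.range c₁) = Λ := b₁.ofZLatticeBasis_span ℝ Λ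
  have h₂ : Submodule.span ℤ (Set.range c₂) = M := b₂.ofZLatticeBasis_span ℝ M
  rw [← h₁, ← h₂, c₁.mem_span_iff_repr_mem ℤ, c₂.mem_span_iff_repr_mem ℤ]
  refine forall_congr' fun i => ?_
  have : c₂.repr (c₁.equiv c₂ (Equiv.refl _) x) i = c₁.repr x i := by
    simp [Module.Basis.equiv]
  rw [← this]
  rfl

end Transport

/-! ### The bounds and the extremal bodies combined -/

theorem theorem1p1 (d : ℕ) (hd : 1 ≤ d) :
    (∀ (Λ : Submodule ℤ (EuclideanSpace ℝ (Fin d))) [DiscreteTopology Λ] [IsZLattice ℝ Λ],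
      (∀ C : Set (EuclideanSpace ℝ (Fin d)), IsLatticeReduced Λ C →
        IsPolytope C ∧
        (polytopeVertices C).encard ≤ ((2 ^ (d + 1) - 2 : ℕ) : ℕ∞) ∧
        (polytopeVertices C).encard ≤
          ((2 ^ (Module.finrank ℝ (Submodule.span ℝ (widthDirections Λ C)) + 1) - 2 : ℕ) : ℕ∞)) ∧
      (∀ C : Set (EuclideanSpace ℝ (Fin d)), IsLatticeComplete Λ C →
        IsPolytope C ∧
        (polytopeFacets C).encard ≤ ((2 ^ (d + 1) - 2 : ℕ) : ℕ∞) ∧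
        (polytopeFacets C).encard ≤
          ((2 ^ (Module.finrank ℝ (Submodule.span ℝ (diameterDirections Λ C)) + 1) - 2 : ℕ)
            : ℕ∞)) ∧
      (∃ C : Set (EuclideanSpace ℝ (Fin d)), IsLatticeReduced Λ C ∧
        (polytopeVertices C).encard = ((2 ^ (d + 1) - 2 : ℕ) : ℕ∞)) ∧
      (∃ C : Set (EuclideanSpace ℝ (Fin d)), IsLatticeComplete Λ C ∧
        (polytopeFacets C).encard = ((2 ^ (d + 1) - 2 : ℕ) : ℕ∞))) ∧
    (IsLatticeComplete (dualLattice (rootLatticeA d))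
        (voronoiCell (dualLattice (rootLatticeA d))) ∧
      (polytopeFacets (voronoiCell (dualLattice (rootLatticeA d)))).encard =
        ((2 ^ (d + 1) - 2 : ℕ) : ℕ∞) ∧
      IsLatticeReduced (rootLatticeA d)
        (polarBody (voronoiCell (dualLattice (rootLatticeA d)))) ∧
      (polytopeVertices (polarBody (voronoiCell (dualLattice (rootLatticeA d))))).encard =
        ((2 ^ (d + 1) - 2 : ℕ) : ℕ∞)) := by
  have hrel := isVoronoiRelevant_subsetVector hd
  have hcomplete := hrel.isLatticeComplete
  have hreduced := hrel.isLatticeReduced_polarBody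
  have hfacets := hrel.encard_polytopeFacets
  have hvertices := hrel.encard_polytopeVertices_polarBody
  rw [card_properSubset] at hfacets hvertices
  refine ⟨?_, hcomplete, hfacets, hreduced, hvertices⟩
  intro Λ _ _
  -- This makes the space nontrivial; in dimension 0 the only point would be both extreme and
  -- interior.
  have : Nonempty (Fin d) := ⟨⟨0, hd⟩⟩
  have hmono : ∀ D : Set (EuclideanSpace ℝ (Fin d)),
      ((2 ^ (Module.finrank ℝ (Submodule.span ℝ D) + 1) - 2 : ℕ) : ℕ∞) ≤
        ((2 ^ (d + 1) - 2 : ℕ) : ℕ∞) := by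
    intro D
    have h := Submodule.finrank_le (Submodule.span ℝ D)
    rw [finrank_euclideanSpace_fin] at h
    exact_mod_cast Nat.sub_le_sub_right
      (Nat.pow_le_pow_right two_pos (Nat.add_le_add_right h 1)) 2
  have hrank : Module.finrank ℝ (SumZeroSpace d) =
      Module.finrank ℝ (EuclideanSpace ℝ (Fin d)) := by
    rw [finrank_sumZeroSpace, finrank_euclideanSpace_fin]
  refine ⟨fun C hC => ?_, fun C hC => ?_, ?_, ?_⟩
  · exact ⟨hC.isPolytope, hC.encard_vertices_le.trans (hmono _), hC.encard_vertices_le⟩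
  · exact ⟨hC.isPolytope, hC.encard_facets_le.trans (hmono _), hC.encard_facets_le⟩
  · obtain ⟨T, hT⟩ := exists_continuousLinearEquiv_mem_iff (rootLatticeA d) Λ hrank
    exact ⟨_, hreduced.image T hT, by rw [encard_polytopeVertices_image, hvertices]⟩
  · obtain ⟨T, hT⟩ := exists_continuousLinearEquiv_mem_iff (dualLattice (rootLatticeA d)) Λ hrank
    exact ⟨_, hcomplete.image T hT, by rw [encard_polytopeFacets_image, hfacets]⟩
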